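/- Let $\Gamma$ be a ranked alphabet. The \emph{leaf substitution algebra} over $\Gamma$ has a type for each $n\in\mathbb N$, whose domain $\mathbb D_n$ is the set of \emph{linear terms} with $n$ placeholders (terms over $\Gamma\cup\{x_1,\dots,x_n\}$ whose variable occurrences, from left to right, are exactly $x_1,\dots,x_n$), and a special initial type whose domain is the singleton $\{x_1\}$ (one placeholder). Writing $a(\alpha)$ for the number of placeholders of the data of type $\alpha$, an \emph{update} from $\alpha$ to $\beta$ is a map $t\mapsto t[u_1,\dots,u_{a(\alpha)}]$ from the domain of $\alpha$ to the domain of $\beta$, which substitutes, at the leaves, a tuple of linear terms with $a(\beta)$ placeholders in total. Outputs are ground terms, i.e. data of type $0$. Each control state of a set $Q$ carries a type, and a \emph{configuration} is a pair $(q,d)$ with $d$ in the domain of the type of $q$. A \emph{transformation} is a partial function between configuration spaces which, on each state $q$, is either nowhere defined or of the form $(q,d)\mapsto(r,g(d))$ for a fixed state $r$ and a fixed update $g$. A \emph{downward string-to-term transducer} over an input alphabet $\Sigma$ consists of a (possibly infinite) typed state set $Q$, a transformation from the one-element initial space to the configurations of $Q$, a transformation of the configurations of $Q$ for each $a\in\Sigma$,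 and a transformation from the configurations of $Q$ to the final space (one state, of type $0$). Composing these along an input word gives the realized transduction, a partial function from $\Sigma^*$ to ground terms. A \emph{morphism} of transducers is a transformation between their configuration spaces that commutes, as a partial function, with the initial, internal and final transformations. For a transduction $\varphi$, the transducers that realize $\varphi$ form a category with these morphisms. An object of it is \emph{algebraically minimal} if it is a quotient (via an epi) of a subobject (via a strong mono) of every object. \textbf{Theorem.} (1) Every transduction realized by a downward string-to-term transducer is realized by an algebraically minimal one. (2) Suppose that the input alphabet is finite and that the symbols of $\Gamma$ are effectively encoded with a computable rank function (as is always possible if $\Gamma$ is finite). Then every transducer with finitely many states has a finite presentation (the list of the states with their types, and for each transition its target and the tuple of linear terms that specifies its update), and there is an algorithm that, given any presentation of any such transducer $A$, halts and returns a presentation of a finite-state transducer that realizes the same transduction as $A$ and is algebraically minimal. -/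

import Mathlib

open CategoryTheory

universe u v

namespace STT

/-! ## Data structures -/

/-- A data structure: an algebra of typed data together with a class of updates (functions between
the domains) that contains the identities and is closed under composition. The special types `init`
(with a singleton domain) and `halt` (the type of output values) are part of the data structure. -/
structure DataStructure where
  Ty : Type
  countable_ty : Countable Ty
  Dom : Ty → Type v
  IsUpdate : {α β : Ty} → (Dom α → Dom β) → Prop
  isUpdate_id : ∀ α : Ty, IsUpdate (id : Dom α → Dom α)
  isUpdate_comp : ∀ {α β γ : Ty} {f : Dom α → Dom β} {g : Dom β → Dom γ},
    IsUpdate f → IsUpdate g → IsUpdate (g ∘ f)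
  init : Ty
  halt : Ty
  initDatum : Dom init
  eq_initDatum : ∀ d : Dom init, d = initDatum

/-! ## Configuration spaces and transformations -/

variable {D : DataStructure.{v}}

/-- A set of control states, each with a data type. -/
structure StateSet (D : DataStructure.{v}) where
  carrier : Type u
  ty : carrier → D.Ty

/-- The configuration space generated by a typed set of control states. -/
abbrev StateSet.Config (Q : StateSet.{u} D) : Type (max u v) :=
  Σ q : Q.carrier, D.Dom (Q.ty q)

/-- A transformation is a partial function between configuration spaces (`none` = undefined) such
that on each control state it is either nowhere defined, or it moves to a fixed control state and
applies a fixed update to the data. -/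
def IsTransformation {Q Q' : StateSet.{u} D} (f : Q.Config → Option Q'.Config) : Prop :=
  ∀ q : Q.carrier, (∀ d, f ⟨q, d⟩ = none) ∨
    ∃ (r : Q'.carrier) (g : D.Dom (Q.ty q) → D.Dom (Q'.ty r)),
      D.IsUpdate g ∧ ∀ d, f ⟨q, d⟩ = some ⟨r, g d⟩

@[ext]
structure Transformation (Q Q' : StateSet.{u} D) where
  toFun : Q.Config → Option Q'.Config
  isTransformation : IsTransformation toFun

/-- The identity transformation. -/
def Transformation.id (Q : StateSet.{u} D) : Transformation Q Q where
  toFun := some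
  isTransformation q := Or.inr ⟨q, _, D.isUpdate_id _, fun _ => rfl⟩

/-- Composition of partial functions, in diagrammatic order. -/
def Transformation.comp {Q Q' Q'' : StateSet.{u} D} (f : Transformation Q Q')
    (g : Transformation Q' Q'') : Transformation Q Q'' where
  toFun c := (f.toFun c).bind g.toFun
  isTransformation q := by
    rcases f.isTransformation q with hf | ⟨r, a, ha, hf⟩
    · exact Or.inl fun d => by simp [hf d]
    · rcases g.isTransformation r with hg | ⟨s, b, hb, hg⟩
      · exact Or.inl fun d => by simp [hf d, hg]
      · exact Or.inr ⟨s, b ∘ a, D.isUpdate_comp ha hb, fun d => by simp [hf d, hg]⟩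

instance : Category (StateSet.{u} D) where
  Hom := Transformation
  id := Transformation.id
  comp := Transformation.comp
  id_comp _ := Transformation.ext (funext fun _ => rfl)
  comp_id _ := Transformation.ext (funext fun _ => Option.bind_fun_some _)
  assoc _ _ _ := Transformation.ext (funext fun _ => Option.bind_assoc _ _ _)

/-- The space with the single configuration (initial state, initial datum). -/
def initSpace (D : DataStructure.{v}) : StateSet.{u} D := ⟨PUnit, fun _ => D.init⟩

/-- The space of final configurations. -/
def haltSpace (D : DataStructure.{v}) : StateSet.{u} D := ⟨PUnit, fun _ => D.halt⟩

/-! ## Transducers -/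

/-- A deterministic streaming transducer over the data structure `D` with input alphabet `S`. -/
structure Transducer (D : DataStructure.{v}) (S : Type u) where
  Q : StateSet.{u} D
  dInit : initSpace D ⟶ Q
  dStep : S → (Q ⟶ Q)
  dHalt : Q ⟶ haltSpace D

variable {S : Type u}

/-- The transformation induced by an input word. -/
def Transducer.run (A : Transducer D S) : List S → (A.Q ⟶ A.Q)
  | [] => 𝟙 A.Q
  | a :: w => A.dStep a ≫ A.run w

/-- The transduction realized by a transducer, a partial function from words to output values. -/
def Transducer.transduction (A : Transducer D S) (w : List S) : Option (D.Dom D.halt) :=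
  ((A.dInit ≫ A.run w ≫ A.dHalt).toFun ⟨PUnit.unit, D.initDatum⟩).map fun c => c.2

/-- A morphism of transducers: a transformation between the configuration spaces that commutes with
the initial, internal and final transformations (as partial functions). -/
@[ext]
structure Transducer.Hom (A B : Transducer D S) where
  map : A.Q ⟶ B.Q
  init_comm : A.dInit ≫ map = B.dInit
  step_comm : ∀ a, A.dStep a ≫ map = map ≫ B.dStep a
  halt_comm : A.dHalt = map ≫ B.dHalt

instance : Category (Transducer D S) where
  Hom := Transducer.Hom
  id A := ⟨𝟙 A.Q, Category.comp_id _, fun _ => by simp, by simp⟩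
  comp f g := ⟨f.map ≫ g.map,
    by rw [← Category.assoc, f.init_comm, g.init_comm],
    fun a => by rw [← Category.assoc, f.step_comm, Category.assoc, g.step_comm, Category.assoc],
    by rw [Category.assoc, ← g.halt_comm, f.halt_comm]⟩
  id_comp _ := Transducer.Hom.ext (Category.id_comp _)
  comp_id _ := Transducer.Hom.ext (Category.comp_id _)
  assoc _ _ _ := Transducer.Hom.ext (Category.assoc _ _ _)

/-- The transducers that realize a given transduction. -/
structure Realizer (φ : List S → Option (D.Dom D.halt)) where
  transducer : Transducer D S
  realizes : transducer.transduction = φ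

/-- The category of the transducers that realize `φ`, with all transducer morphisms as arrows. -/
instance (φ : List S → Option (D.Dom D.halt)) : Category (Realizer φ) where
  Hom A B := A.transducer ⟶ B.transducer
  id A := 𝟙 A.transducer
  comp f g := CategoryStruct.comp (obj := Transducer D S) f g
  id_comp f := Category.id_comp (obj := Transducer D S) f
  comp_id f := Category.comp_id (obj := Transducer D S) f
  assoc f g h := Category.assoc (obj := Transducer D S) f g h

/-! ## Algebraic minimality -/

/-- `A` is a subquotient of `B`: a quotient (along an epi) of a subobject (along a strong mono). -/
def IsSubquotient {C : Type*} [Category C] (A B : C) : Prop :=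
  ∃ X : C, (∃ e : X ⟶ A, Epi e) ∧ ∃ m : X ⟶ B, StrongMono m

/-- `A` is algebraically minimal in its category. -/
def AlgebraicallyMinimal {C : Type*} [Category C] (A : C) : Prop :=
  ∀ B : C, IsSubquotient A B

/-! ## Terms and the leaf substitution algebra -/

/-- Terms over a ranked alphabet, with variables (of rank `0`) in `X`. -/
inductive Term {Γ : Type v} (rank : Γ → ℕ) (X : Type) : Type v
  | var (x : X) : Term rank X
  | node (g : Γ) (ts : Fin (rank g) → Term rank X) : Term rank X

variable {Γ : Type v} {rank : Γ → ℕ}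

namespace Term

variable {X Y Z : Type}

/-- First-order substitution. -/
def subst : Term rank X → (X → Term rank Y) → Term rank Y
  | var x, u => u x
  | node g ts, u => node g fun i => (ts i).subst u

/-- The variable occurrences of a term, from left to right. -/
def vars : Term rank X → List X
  | var x => [x]
  | node _ ts => (List.ofFn fun i => (ts i).vars).flatten

theorem subst_var (t : Term rank X) : t.subst var = t := by
  induction t with
  | var x => rfl
  | node g ts ih => simp only [subst, ih]

theorem subst_subst (t : Term rank X) (u : X → Term rank Y) (w : Y → Term rank Z) :
    (t.subst u).subst w = t.subst fun x => (u x).subst w := by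
  induction t with
  | var x => rfl
  | node g ts ih => simp only [subst, ih]

theorem vars_subst (t : Term rank X) (u : X → Term rank Y) :
    (t.subst u).vars = t.vars.flatMap fun x => (u x).vars := by
  induction t with
  | var x => simp [subst, vars]
  | node g ts ih =>
    simp only [subst, vars, ih, List.flatMap_def, List.map_flatten, List.flatten_flatten,
      List.map_ofFn]
    rfl

end Term

/-- A tuple of linear terms with `b` variable occurrences in total: read from left to right through
the whole tuple, these are exactly `x₁, …, x_b`. -/
def IsLinearTuple {a b : ℕ} (u : Fin a → Term rank (Fin b)) : Prop :=
  (List.finRange a).flatMap (fun i => (u i).vars) = List.finRange b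

/-- The types of the leaf substitution algebra are the natural numbers `some n` and the special
initial type `none`. The domain of the latter is the singleton of the linear term that consists of a
single placeholder, hence there is one placeholder in the data of this type. -/
abbrev arity : Option ℕ → ℕ
  | none => 1
  | some n => n

/-- The domain of type `n` consists of the linear terms with `n` placeholders: terms in which the
variable occurrences are, from left to right, exactly `x₁, …, x_n`. The domain of the initial type
consists only of the linear term `x₁`. -/
def leafDom (rank : Γ → ℕ) (α : Option ℕ) : Set (Term rank (Fin (arity α))) :=
  {t | t.vars = List.finRange (arity α) ∧ (α = none → ∃ x, t = Term.var x)}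

/-- The function `g` is the update specified by the tuple `u` of linear terms: it substitutes `u`
for the placeholders of its argument. -/
def Specifies {α β : Option ℕ} (u : Fin (arity α) → Term rank (Fin (arity β)))
    (g : leafDom rank α → leafDom rank β) : Prop :=
  IsLinearTuple u ∧ ∀ t, (g t : Term rank (Fin (arity β))) = (t : Term rank (Fin (arity α))).subst u

/-- The leaf substitution algebra over a ranked alphabet; the outputs are the ground terms. -/
def leafAlgebra (rank : Γ → ℕ) : DataStructure.{v} where
  Ty := Option ℕ
  countable_ty := inferInstance
  Dom α := leafDom rank α
  IsUpdate g := ∃ u, Specifies u g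
  isUpdate_id α := ⟨Term.var, by simp [IsLinearTuple, Term.vars], fun t => (t.1.subst_var).symm⟩
  isUpdate_comp := by
    rintro α β γ f g ⟨u, hu, hf⟩ ⟨w, hw, hg⟩
    refine ⟨fun i => (u i).subst w, ?_, fun t => ?_⟩
    · unfold IsLinearTuple at *
      simp only [Term.vars_subst]
      rw [← List.flatMap_assoc, hu, hw]
    · rw [Function.comp_apply, hg, hf, Term.subst_subst]
  init := none
  halt := some 0
  initDatum := ⟨Term.var (0 : Fin 1), rfl, fun _ => ⟨_, rfl⟩⟩
  eq_initDatum := by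
    rintro ⟨t, ht, h⟩
    obtain ⟨x, rfl⟩ := h rfl
    exact Subtype.ext (congrArg Term.var (Subsingleton.elim (α := Fin 1) x 0))

/-! ## Finite presentations of finite transducers over the leaf substitution algebra -/

/-- Terms written in Polish notation, every placeholder being written as `none`. -/
def Term.code {X : Type} : Term rank X → List (Option Γ)
  | var _ => [none]
  | node g ts => some g :: (List.ofFn fun i => (ts i).code).flatten

abbrev TupleCode (Γ : Type v) : Type v := List (List (Option Γ))

def tupleCode {a b : ℕ} (u : Fin a → Term rank (Fin b)) : TupleCode Γ :=
  List.ofFn fun i => (u i).code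

/-- Finite descriptions of transducers with states `0, …, n - 1` and input alphabet `Fin m`: the
initial transition (if any), and a list with one entry per state, holding the type of the state, its
transition for each letter (if any), and its final transition (if any). A transition is described by
the number of its target state and by the tuple of linear terms that specifies the update. -/
abbrev Code (Γ : Type v) (m : ℕ) : Type v :=
  Option (ℕ × TupleCode Γ) ×
    List (Option ℕ × (Fin m → Option (ℕ × TupleCode Γ)) × Option (TupleCode Γ))

/-- On the state `q`, the transformation `f` is as described by the entry `o`, where the target
states are numbered by `num`. -/
def Describes {Q Q' : StateSet.{u} (leafAlgebra rank)} (num : Q'.carrier → ℕ) (f : Q ⟶ Q')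
    (q : Q.carrier) (o : Option (ℕ × TupleCode Γ)) : Prop :=
  match o with
  | none => ∀ d, f.toFun ⟨q, d⟩ = none
  | some (k, c) => ∃ (r : Q'.carrier)
      (t : Fin (arity (Q.ty q)) → Term rank (Fin (arity (Q'.ty r))))
      (g : leafDom rank (Q.ty q) → leafDom rank (Q'.ty r)),
      num r = k ∧ tupleCode t = c ∧ Specifies t g ∧ ∀ d, f.toFun ⟨q, d⟩ = some ⟨r, g d⟩

/-- The finite description `c` presents the transducer `A` (up to a numbering of its states). -/
def Presents {m : ℕ} (c : Code Γ m) (A : Transducer (leafAlgebra rank) (Fin m)) : Prop :=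
  ∃ e : A.Q.carrier ≃ Fin c.2.length,
    Describes (fun r => (e r : ℕ)) A.dInit PUnit.unit c.1 ∧
    ∀ q : A.Q.carrier,
      A.Q.ty q = (c.2.get (e q)).1 ∧
      (∀ a, Describes (fun r => (e r : ℕ)) (A.dStep a) q ((c.2.get (e q)).2.1 a)) ∧
      Describes (fun _ => 0) A.dHalt q ((c.2.get (e q)).2.2.map fun x => (0, x))

end STT

/-! A somewhere defined partial family of ground terms, such as `v ↦ ψ (w ++ v)`, has a greatest
common prefix: a linear term `p` that is a prefix of all members and leaves tuples which, in every
coordinate, begin with at least two different root symbols (`Term.exists_linear_irreducible`). What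
remains after `p` is removed is unique (`Term.sigma_eq_of_irreducible`), and any other linear common
prefix extends to `p` by a linear tuple (`Term.exists_isLinearTuple`). The states of the minimal
transducer are the irreducible families that remain for the live words `w`; its datum after `w` is
the greatest common prefix, so output is produced as early as possible.

Minimality only uses that all states are reachable and have irreducible, pairwise distinct residuals
(`IsReduced`). If another realizer `B` reaches `(q, d)` where the reduced one reaches `(r, e)`, then
`d` is a common prefix of the family whose greatest common prefix is `e`, so an update sends `d` to
`e`; since the residual of `q` factors through the same tuple, `r` and the update depend on `q`
alone (`IsReduced.exists_hom`). The reachable part of `B` is the equalizer of two embeddings of `B`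
in its double, hence a strong subobject (`strongMono_inclHom`), and it maps onto the reduced
transducer. Because an update is determined by a single value (`leafAlgebra_rigid`), commutation and
the epi property need to be tested only at one reached datum per state
(`isSubquotient_of_config_eq`).

The algorithm is an unbounded search for a presentation with a finite certificate: a simulation that
proves equivalence, words that witness reachability, irreducibility and distinctness, and a table of
ranks by which the tuples are parsed. Checking is effective. Any certified answer is correct
(`Certifies.exists_minimal`). The search halts because each state of the reduced transducer is the
image of a state of the given one, so it is finite and has a certified presentation
(`Presents.exists_certifies`). -/

namespace STT

/-! ### Cutting a concatenation back into its blocks. -/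

section ListLemmas

variable {α β : Type*}

/-- `H` says that the blocks delimit themselves, so they can be read off from the left. It is
applied to codes of terms and to blocks of known lengths. -/
theorem flatten_ofFn_append_inj {n : ℕ} {f g : Fin n → List α} {l l' : List α}
    (H : ∀ i (l l' : List α), f i ++ l = g i ++ l' → f i = g i ∧ l = l')
    (h : (List.ofFn f).flatten ++ l = (List.ofFn g).flatten ++ l') : f = g ∧ l = l' := by
  induction n with
  | zero => exact ⟨funext fun i => i.elim0, by simpa using h⟩
  | succ n ih =>
    simp only [List.ofFn_succ, List.flatten_cons, List.append_assoc] at h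
    obtain ⟨h0, h1⟩ := H 0 _ _ h
    obtain ⟨h2, h3⟩ := ih (fun i => H i.succ) h1
    exact ⟨funext fun i => Fin.cases h0 (fun j => congrFun h2 j) i, h3⟩

theorem flatten_ofFn_inj_of_length {n : ℕ} {f g : Fin n → List α}
    (H : ∀ i, (f i).length = (g i).length)
    (h : (List.ofFn f).flatten = (List.ofFn g).flatten) : f = g :=
  (flatten_ofFn_append_inj (l := []) (l' := [])
    (fun i _ _ e => List.append_inj e (H i)) (by simpa using h)).1

theorem exists_flatten_ofFn_eq {n : ℕ} (f : Fin n → List α) (l : List β)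
    (h : l.length = (List.ofFn f).flatten.length) :
    ∃ g : Fin n → List β, (∀ i, (g i).length = (f i).length) ∧ (List.ofFn g).flatten = l := by
  induction n generalizing l with
  | zero => exact ⟨fun _ => [], fun i => i.elim0, by simpa using h⟩
  | succ n ih =>
    simp only [List.ofFn_succ, List.flatten_cons, List.length_append] at h
    obtain ⟨g, hg, hl⟩ := ih (fun i => f i.succ) (l.drop (f 0).length)
      (by rw [List.length_drop]; omega)
    refine ⟨Fin.cases (l.take (f 0).length) g, fun i => ?_, ?_⟩
    · induction i using Fin.cases with
      | zero => simp only [Fin.cases_zero, List.length_take]; omega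
      | succ i => exact hg i
    · simp only [List.ofFn_succ, Fin.cases_zero, Fin.cases_succ, List.flatten_cons, hl,
        List.take_append_drop]

theorem flatten_ofFn_nodup_unique {n : ℕ} {f : Fin n → List α}
    (h : (List.ofFn f).flatten.Nodup) {i j : Fin n} {x : α} (hi : x ∈ f i) (hj : x ∈ f j) :
    i = j := by
  rw [List.nodup_flatten, List.pairwise_ofFn] at h
  by_contra hne
  rcases lt_or_gt_of_ne hne with hlt | hlt
  · exact h.2 hlt hi hj
  · exact h.2 hlt hj hi

end ListLemmas

variable {Γ : Type v} {rank : Γ → ℕ}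

/-! ### Terms up to variable names, and greatest common prefixes. -/

namespace Term

variable {V : Type*} {X Y Z : Type}

theorem mem_vars_node {g : Γ} {ts : Fin (rank g) → Term rank X} {x : X} :
    x ∈ (node g ts).vars ↔ ∃ i, x ∈ (ts i).vars := by
  simp [vars, List.mem_flatten, List.mem_ofFn]

theorem subst_congr_iff (t : Term rank X) {f g : X → Term rank Y} :
    t.subst f = t.subst g ↔ ∀ x ∈ t.vars, f x = g x := by
  induction t with
  | var x => simp [subst, vars]
  | node c ts ih =>
    simp only [subst, mem_vars_node, node.injEq, heq_eq_eq, true_and, funext_iff, ih]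
    grind

/-- Polish notation is a prefix code: the rank of the first symbol tells how many codes of subterms
follow. The variable types may differ because codes forget names. -/
theorem code_append_inj {t : Term rank X} {t' : Term rank Y} {l l' : List (Option Γ)}
    (h : t.code ++ l = t'.code ++ l') : t.code = t'.code ∧ l = l' := by
  induction t generalizing t' l l' with
  | var x =>
    cases t' with
    | var y => simpa [code] using h
    | node g ts => simp [code] at h
  | node g ts ih =>
    cases t' with
    | var y => simp [code] at h
    | node g' ts' =>
      simp only [code, List.cons_append, List.cons.injEq, Option.some.injEq] at h
      obtain ⟨rfl, h⟩ := h
      obtain ⟨h1, h2⟩ := flatten_ofFn_append_inj (fun i l l' e => ih i e) h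
      refine ⟨?_, h2⟩
      simp only [code]
      rw [h1]

theorem code_node_inj {g : Γ} {ts : Fin (rank g) → Term rank X} {ts' : Fin (rank g) → Term rank Y}
    (h : (node g ts).code = (node g ts').code) (i : Fin (rank g)) : (ts i).code = (ts' i).code := by
  simp only [code, List.cons.injEq, true_and] at h
  exact congrFun (flatten_ofFn_append_inj (l := []) (l' := [])
    (fun i l l' e => code_append_inj e) (by simpa using h)).1 i

theorem length_vars (t : Term rank X) : t.vars.length = t.code.countP Option.isNone := by
  induction t with
  | var x => simp [vars, code]
  | node g ts ih => simp [vars, code, List.length_flatten, List.countP_flatten, List.map_ofFn, ih,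
      Function.comp_def]

theorem length_vars_eq {t : Term rank X} {t' : Term rank Y} (h : t.code = t'.code) :
    t.vars.length = t'.vars.length := by rw [length_vars, length_vars, h]

/-- A substitution sees only the shape of the term and the sequence of terms that arrive at its
leaves. -/
theorem subst_eq_of_code_eq {t : Term rank X} {t' : Term rank Y} (h : t.code = t'.code)
    {f : X → Term rank Z} {f' : Y → Term rank Z} (hf : t.vars.map f = t'.vars.map f') :
    t.subst f = t'.subst f' := by
  induction t generalizing t' with
  | var x =>
    cases t' with
    | var y => simpa [vars, subst] using hf
    | node g ts => simp [code] at h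
  | node g ts ih =>
    cases t' with
    | var y => simp [code] at h
    | node g' ts' =>
      obtain rfl : g = g' := by simp only [code, List.cons.injEq, Option.some.injEq] at h; exact h.1
      have hc := code_node_inj h
      simp only [vars, List.map_flatten, List.map_ofFn] at hf
      have := flatten_ofFn_inj_of_length (fun i => by simpa using length_vars_eq (hc i)) hf
      simp only [subst, node.injEq, heq_eq_eq, true_and]
      exact funext fun i => ih i (hc i) (congrFun this i)

theorem eq_of_code_eq {t t' : Term rank X} (h : t.code = t'.code) (hv : t.vars = t'.vars) :
    t = t' := by
  rw [← t.subst_var, ← t'.subst_var, subst_eq_of_code_eq h (by rw [hv])]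

theorem exists_relabel (t : Term rank X) (l : List Y) (h : l.length = t.vars.length) :
    ∃ t' : Term rank Y, t'.vars = l ∧ t'.code = t.code := by
  induction t generalizing l with
  | var x =>
    obtain ⟨y, rfl⟩ := List.length_eq_one_iff.1 h
    exact ⟨var y, rfl, rfl⟩
  | node g ts ih =>
    obtain ⟨ls, h1, h2⟩ := exists_flatten_ofFn_eq _ l h
    choose ts' h3 h4 using fun i => ih i (ls i) (h1 i)
    exact ⟨node g ts', by simp only [vars, h3, h2], by simp only [code, h4]⟩

/-- The symbol at the root, if it is not a variable. -/
def root : Term rank X → Option Γ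
  | var _ => none
  | node g _ => some g

/-- A partial family of tuples of terms without a common prefix: it is somewhere defined, and in
each coordinate there are two members with different roots. -/
structure IsIrreducible (F : V → Option (Y → Term rank Z)) : Prop where
  exists_eq_some : ∃ v f, F v = some f
  exists_root_ne : ∀ y, ∃ v f v' f', F v = some f ∧ F v' = some f' ∧ (f y).root ≠ (f' y).root

/-- Otherwise coordinate `y` of every defined member of `G` would have root `g`. -/
theorem IsIrreducible.not_node {G : V → Option (Y → Term rank Z)} (hG : IsIrreducible G) {g : Γ}
    {ts : Fin (rank g) → Term rank X} {y : Y} {F : V → Option (X → Term rank Z)}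
    (H : ∀ v, (F v).map (node g ts).subst = (G v).map (var y).subst) : False := by
  obtain ⟨v, f, v', f', h1, h2, h3⟩ := hG.exists_root_ne y
  have e1 := H v
  have e2 := H v'
  rw [h1] at e1
  rw [h2] at e2
  simp only [Option.map_some, Option.map_eq_some_iff, subst] at e1 e2
  obtain ⟨a, -, ha⟩ := e1
  obtain ⟨b, -, hb⟩ := e2
  exact h3 (by rw [← ha, ← hb]; rfl)

theorem eq_of_subst_node {F : V → Option (X → Term rank Z)} {G : V → Option (Y → Term rank Z)}
    {g g' : Γ} {ts : Fin (rank g) → Term rank X} {ts' : Fin (rank g') → Term rank Y}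
    (hG : ∃ v f, G v = some f)
    (H : ∀ v, (F v).map (node g ts).subst = (G v).map (node g' ts').subst) : g = g' := by
  obtain ⟨v, f, hv⟩ := hG
  have := H v
  rw [hv] at this
  simp only [Option.map_some, Option.map_eq_some_iff, subst] at this
  obtain ⟨a, -, ha⟩ := this
  exact (node.inj ha).1

theorem subst_node_child {F : V → Option (X → Term rank Z)} {G : V → Option (Y → Term rank Z)}
    {g : Γ} {ts : Fin (rank g) → Term rank X} {ts' : Fin (rank g) → Term rank Y}
    (H : ∀ v, (F v).map (node g ts).subst = (G v).map (node g ts').subst) (i : Fin (rank g))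
    (v : V) : (F v).map (ts i).subst = (G v).map (ts' i).subst := by
  have := H v
  cases hF : F v <;> cases hG : G v <;> simp_all [subst, funext_iff]

/-- Descend through `d` and `d'` in parallel. Irreducibility of `G` forbids `d'` to end before `d`,
and the symbols agree as long as both continue; where `d` ends, the rest of `d'` is the term to
substitute. Only `G` has to be irreducible: `d'` is then the greatest prefix and `d` an arbitrary
one. -/
theorem exists_subst_eq {F : V → Option (X → Term rank Z)} {G : V → Option (Y → Term rank Z)}
    (hG : IsIrreducible G) (u₀ : X → Term rank Y) {d : Term rank X} {d' : Term rank Y}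
    (hd : d.vars.Nodup) (H : ∀ v, (F v).map d.subst = (G v).map d'.subst) :
    ∃ w, d.subst w = d' := by
  classical
  induction d generalizing d' with
  | var x => exact ⟨fun _ => d', rfl⟩
  | node g ts ih =>
    cases d' with
    | var y => exact (hG.not_node H).elim
    | node g' ts' =>
      obtain rfl := eq_of_subst_node hG.exists_eq_some H
      have hd' : (List.ofFn fun i => (ts i).vars).flatten.Nodup := hd
      have hn : ∀ i, (ts i).vars.Nodup := fun i =>
        (List.nodup_flatten.1 hd').1 _ (List.mem_ofFn.2 ⟨i, rfl⟩)
      choose w hw using fun i => ih i (hn i) (subst_node_child H i)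
      -- The substitutions found for the children are glued; each variable lies in one child only,
      -- since `d` has no repeated variable. `u₀` is a dummy for variables that do not occur.
      refine ⟨fun x => if h : ∃ i, x ∈ (ts i).vars then w h.choose x else u₀ x, ?_⟩
      simp only [subst, node.injEq, heq_eq_eq, true_and]
      funext i
      rw [← hw i, subst_congr_iff]
      intro x hx
      have h : ∃ i, x ∈ (ts i).vars := ⟨i, hx⟩
      rw [dif_pos h, flatten_ofFn_nodup_unique hd' h.choose_spec hx]

/-- With both families irreducible, neither prefix can end before the other. -/
theorem code_eq_of_irreducible {F : V → Option (X → Term rank Z)}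
    {G : V → Option (Y → Term rank Z)} (hF : IsIrreducible F) (hG : IsIrreducible G)
    {d : Term rank X} {d' : Term rank Y} (H : ∀ v, (F v).map d.subst = (G v).map d'.subst) :
    d.code = d'.code := by
  induction d generalizing d' with
  | var x =>
    cases d' with
    | var y => rfl
    | node g' ts' => exact (hF.not_node fun v => (H v).symm).elim
  | node g ts ih =>
    cases d' with
    | var y => exact (hG.not_node H).elim
    | node g' ts' =>
      obtain rfl := eq_of_subst_node hG.exists_eq_some H
      simp only [code]
      rw [funext fun i => ih i (subst_node_child H i)]

/-- While all defined members share their root symbol, strip it and recurse into the children; the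
chosen member `t₀` bounds the recursion. Two different roots stop it with a single placeholder. -/
theorem exists_irreducible [IsEmpty Z] (φ : V → Option (Term rank Z)) {v₀ : V} {t₀ : Term rank Z}
    (h₀ : φ v₀ = some t₀) : ∃ (X : Type) (p : Term rank X) (G : V → Option (X → Term rank Z)),
      IsIrreducible G ∧ ∀ v, φ v = (G v).map p.subst := by
  induction t₀ generalizing φ with
  | var z => exact isEmptyElim z
  | node g ts ih =>
    by_cases hall : ∀ v t, φ v = some t → t.root = some g
    · have : ∀ v, ∃ c : Option (Fin (rank g) → Term rank Z), φ v = c.map (node g) := by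
        intro v
        cases hv : φ v with
        | none => exact ⟨none, rfl⟩
        | some t =>
          have := hall v t hv
          cases t with
          | var z => exact isEmptyElim z
          | node g' us =>
            obtain rfl : g' = g := by simpa [root] using this
            exact ⟨some us, rfl⟩
      choose c hc using this
      have hc₀ : c v₀ = some ts := by
        have := hc v₀
        rw [h₀] at this
        cases h : c v₀ <;> simp_all
      choose Xs p G hG hφ using fun i => ih i (fun v => (c v).map (· i)) (by simp [hc₀])
      -- The families of the children are merged over the disjoint union of their placeholders. The
      -- domain of definition is taken from `c`, since for a symbol of rank 0 there is no child to
      -- read it from.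
      have : ∀ v, ∃ γ : Option ((Σ i, Xs i) → Term rank Z), γ.isSome = (c v).isSome ∧
          ∀ k ∈ γ, ∀ i, G i v = some fun x => k ⟨i, x⟩ := by
        intro v
        cases hv : c v with
        | none => exact ⟨none, rfl, by simp⟩
        | some us =>
          have : ∀ i, ∃ k, G i v = some k := by
            intro i
            have := hφ i v
            rw [hv] at this
            cases h : G i v <;> simp_all
          choose k hk using this
          exact ⟨some fun x => k x.1 x.2, rfl, by rintro _ ⟨rfl⟩ i; exact hk i⟩
      choose K hK1 hK2 using this
      have hK3 : ∀ i v k, G i v = some k → ∃ k', K v = some k' ∧ ∀ x, k' ⟨i, x⟩ = k x := by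
        intro i v k h
        have h1 : (c v).isSome := by
          have := hφ i v
          rw [h] at this
          cases h : c v <;> simp_all
        obtain ⟨k', hk'⟩ := Option.isSome_iff_exists.1 ((hK1 v).trans h1)
        refine ⟨k', hk', fun x => ?_⟩
        have := hK2 v k' hk' i
        rw [h] at this
        exact (congrFun (Option.some.inj this) x).symm
      refine ⟨Σ i, Xs i, node g fun i => (p i).subst fun x => var ⟨i, x⟩, K, ⟨?_, ?_⟩, ?_⟩
      · obtain ⟨k, hk⟩ := Option.isSome_iff_exists.1 ((hK1 v₀).trans (by rw [hc₀]; rfl))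
        exact ⟨v₀, k, hk⟩
      · rintro ⟨i, x⟩
        obtain ⟨v, f, v', f', h1, h2, h3⟩ := (hG i).exists_root_ne x
        obtain ⟨k, hk, hk'⟩ := hK3 i v f h1
        obtain ⟨l, hl, hl'⟩ := hK3 i v' f' h2
        exact ⟨v, k, v', l, hk, hl, by rwa [hk', hl']⟩
      · intro v
        rw [hc]
        cases hk : K v with
        | none =>
          have h1 := hK1 v
          rw [hk] at h1
          have h2 : c v = none := by simpa using h1.symm
          rw [h2]
          rfl
        | some k =>
          obtain ⟨us, hus⟩ := Option.isSome_iff_exists.1 ((hK1 v).symm.trans (by rw [hk]; rfl))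
          rw [hus]
          simp only [Option.map_some, subst, subst_subst, Option.some.injEq, node.injEq, heq_eq_eq,
            true_and]
          funext i
          have := hφ i v
          rw [hus, hK2 v k hk i] at this
          simpa using this
    · push Not at hall
      obtain ⟨v, t, hv, ht⟩ := hall
      refine ⟨Unit, var (), fun v => (φ v).map fun t _ => t, ⟨⟨v₀, _, by rw [h₀]; rfl⟩, fun _ =>
        ⟨v, _, v₀, _, by rw [hv]; rfl, by rw [h₀]; rfl, ht⟩⟩, fun v => ?_⟩
      cases h : φ v <;> simp [h, subst]

/-- Every partial, somewhere defined family of ground terms has a greatest common prefix. -/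
theorem exists_linear_irreducible [IsEmpty Z] (φ : V → Option (Term rank Z))
    (h : ∃ v t, φ v = some t) :
    ∃ (n : ℕ) (p : Term rank (Fin n)) (G : V → Option (Fin n → Term rank Z)),
      p.vars = List.finRange n ∧ IsIrreducible G ∧ ∀ v, φ v = (G v).map p.subst := by
  obtain ⟨v₀, t₀, h₀⟩ := h
  obtain ⟨X, p, G, hG, hφ⟩ := exists_irreducible φ h₀
  -- Numbering the variable occurrences makes the prefix linear. A variable that occurred several
  -- times would have its coordinate duplicated, which does no harm because irreducibility is a
  -- condition on each coordinate.
  obtain ⟨p', hp, hc⟩ := p.exists_relabel (List.finRange p.vars.length) (by simp)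
  refine ⟨_, p', fun v => (G v).map fun γ i => γ (p.vars.get i), hp, ⟨?_, fun i => ?_⟩, fun v => ?_⟩
  · obtain ⟨v, f, hv⟩ := hG.exists_eq_some
    exact ⟨v, _, by rw [hv]; rfl⟩
  · obtain ⟨v, f, v', f', h1, h2, h3⟩ := hG.exists_root_ne (p.vars.get i)
    exact ⟨v, _, v', _, by rw [h1]; rfl, by rw [h2]; rfl, h3⟩
  · rw [hφ, Option.map_map]
    congr 1
    funext γ
    refine subst_eq_of_code_eq hc.symm ?_
    rw [hp]
    conv_lhs => rw [← List.map_get_finRange p.vars]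
    rw [List.map_map]
    rfl

end Term

end STT

/-! ### Strong subobjects and subquotients over a general data structure. -/

namespace STT

variable {D : DataStructure.{v}} {S : Type u}

section Transformations

variable {Q Q' Q'' : StateSet.{u} D}

theorem hom_ext {f g : Q ⟶ Q'} (h : ∀ c, f.toFun c = g.toFun c) : f = g :=
  Transformation.ext (funext h)

theorem comp_toFun (f : Q ⟶ Q') (g : Q' ⟶ Q'') (c : Q.Config) :
    (f ≫ g).toFun c = (f.toFun c).bind g.toFun := rfl

theorem Transformation.exists_eq_some (f : Transformation Q Q') {q : Q.carrier} {d : D.Dom (Q.ty q)}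
    {c : Q'.Config} (h : f.toFun ⟨q, d⟩ = some c) (d' : D.Dom (Q.ty q)) :
    ∃ e, f.toFun ⟨q, d'⟩ = some ⟨c.1, e⟩ := by
  rcases f.isTransformation q with h' | ⟨r, g, -, hg⟩
  · rw [h'] at h
    cases h
  · rw [hg] at h
    cases h
    exact ⟨_, hg d'⟩

/-- In a rigid data structure, an update is determined by its value at a single datum. -/
def DataStructure.Rigid (D : DataStructure.{v}) : Prop :=
  ∀ ⦃α β : D.Ty⦄ (g g' : D.Dom α → D.Dom β), D.IsUpdate g → D.IsUpdate g' →
    ∀ d, g d = g' d → g = g'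

theorem DataStructure.Rigid.eq_on_state (hD : D.Rigid) (f f' : Transformation Q Q')
    {q : Q.carrier} {d : D.Dom (Q.ty q)} (h : f.toFun ⟨q, d⟩ = f'.toFun ⟨q, d⟩)
    (d' : D.Dom (Q.ty q)) : f.toFun ⟨q, d'⟩ = f'.toFun ⟨q, d'⟩ := by
  rcases f.isTransformation q with h1 | ⟨r, g, hg, h1⟩ <;>
  rcases f'.isTransformation q with h2 | ⟨r', g', hg', h2⟩
  · rw [h1, h2]
  · rw [h1, h2] at h
    cases h
  · rw [h1, h2] at h
    cases h
  · rw [h1, h2, Option.some.injEq, Sigma.mk.injEq] at h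
    obtain ⟨rfl, h⟩ := h
    rw [h1, h2, hD g g' hg hg' d (eq_of_heq h)]

end Transformations

namespace Transducer

variable {A B : Transducer D S}

theorem run_append (A : Transducer D S) (w w' : List S) :
    A.run (w ++ w') = A.run w ≫ A.run w' := by
  induction w with
  | nil => exact (Category.id_comp _).symm
  | cons a w ih => simp only [List.cons_append, run, ih, Category.assoc]

/-- The configuration that is reached after reading a word. -/
def config (A : Transducer D S) (w : List S) : Option A.Q.Config :=
  (A.dInit ≫ A.run w).toFun ⟨PUnit.unit, D.initDatum⟩

theorem config_nil (A : Transducer D S) :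
    A.config [] = A.dInit.toFun ⟨PUnit.unit, D.initDatum⟩ := by
  simp only [config, run, Category.comp_id]

theorem config_append (A : Transducer D S) (w w' : List S) :
    A.config (w ++ w') = (A.config w).bind (A.run w').toFun := by
  simp only [config, run_append, ← Category.assoc]
  rfl

theorem config_concat (A : Transducer D S) (w : List S) (a : S) :
    A.config (w ++ [a]) = (A.config w).bind (A.dStep a).toFun := by
  rw [config_append]
  simp only [run, Category.comp_id]

theorem transduction_eq (A : Transducer D S) (w : List S) :
    A.transduction w = ((A.config w).bind A.dHalt.toFun).map fun c => c.2 := by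
  simp only [transduction, config, ← Category.assoc]
  rfl

theorem Hom.config_eq (f : A.Hom B) (w : List S) :
    B.config w = (A.config w).bind f.map.toFun := by
  induction w using List.reverseRecOn with
  | nil => rw [config_nil, config_nil, ← comp_toFun, f.init_comm]
  | append_singleton w a ih =>
    rw [config_concat, ih, config_concat, Option.bind_assoc, Option.bind_assoc]
    congr 1
    funext c
    rw [← comp_toFun, ← comp_toFun, f.step_comm]

theorem Hom.transduction_eq (f : A.Hom B) : A.transduction = B.transduction := by
  funext w
  rw [Transducer.transduction_eq, Transducer.transduction_eq, f.config_eq, Option.bind_assoc]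
  congr 2
  funext c
  rw [f.halt_comm]
  rfl

/-- A control state is reachable if it occurs in the configuration after some word. -/
def Reachable (A : Transducer D S) (q : A.Q.carrier) : Prop :=
  ∃ w d, A.config w = some ⟨q, d⟩

/-- A set of control states that is closed under the transitions of a transducer. -/
structure IsClosed (A : Transducer D S) (P : A.Q.carrier → Prop) : Prop where
  init : ∀ c c', A.dInit.toFun c = some c' → P c'.1
  step : ∀ a c c', (A.dStep a).toFun c = some c' → P c.1 → P c'.1

/-- The target state of a transition does not depend on the datum, so a transition from any datum at
a reachable state is also taken from the datum that was reached. -/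
theorem isClosed_reachable (A : Transducer D S) : A.IsClosed A.Reachable where
  init := by
    rintro ⟨q, d⟩ c' h
    rw [D.eq_initDatum d] at h
    exact ⟨[], c'.2, A.config_nil.trans h⟩
  step := by
    rintro a ⟨q, d⟩ c' h ⟨w, d₀, hw⟩
    obtain ⟨e, he⟩ := (A.dStep a).exists_eq_some h d₀
    exact ⟨w ++ [a], e, by rw [A.config_concat, hw]; exact he⟩

section Restriction

variable (A) (P : A.Q.carrier → Prop)

abbrev subStates : StateSet.{u} D := ⟨Subtype P, fun q => A.Q.ty q.1⟩

def incl : A.subStates P ⟶ A.Q where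
  toFun c := some ⟨c.1.1, c.2⟩
  isTransformation q := Or.inr ⟨q.1, _, D.isUpdate_id _, fun _ => rfl⟩

open Classical in
-- A partial retraction of `incl`. It is a transformation, but in general no morphism of
-- transducers.
noncomputable def restr : A.Q ⟶ A.subStates P where
  toFun c := if h : P c.1 then some ⟨⟨c.1, h⟩, c.2⟩ else none
  isTransformation q := by
    by_cases h : P q
    · exact Or.inr ⟨⟨q, h⟩, _, D.isUpdate_id _, fun d => dif_pos h⟩
    · exact Or.inl fun d => dif_neg h

variable {A P}

theorem restr_incl_toFun {c : A.Q.Config} (h : P c.1) :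
    (A.restr P ≫ A.incl P).toFun c = some c := by
  rw [comp_toFun]
  simp only [restr, dif_pos h]
  rfl

theorem incl_restr : A.incl P ≫ A.restr P = 𝟙 _ :=
  hom_ext fun c => dif_pos c.1.2

theorem comp_restr_incl {Q : StateSet.{u} D} (f : Q ⟶ A.Q)
    (h : ∀ c c', f.toFun c = some c' → P c'.1) : f ≫ A.restr P ≫ A.incl P = f := by
  refine hom_ext fun c => ?_
  rw [comp_toFun]
  cases hc : f.toFun c with
  | none => rfl
  | some c' => exact restr_incl_toFun (h c c' hc)

variable (A P) in
/-- The restriction of a transducer to a set of control states. -/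
noncomputable abbrev restrict : Transducer D S where
  Q := A.subStates P
  dInit := A.dInit ≫ A.restr P
  dStep a := A.incl P ≫ A.dStep a ≫ A.restr P
  dHalt := A.incl P ≫ A.dHalt

noncomputable def IsClosed.inclHom (hP : A.IsClosed P) : A.restrict P ⟶ A where
  map := A.incl P
  init_comm := by
    simp only [restrict, Category.assoc]
    exact comp_restr_incl _ hP.init
  step_comm a := by
    simp only [restrict, Category.assoc]
    have : (A.incl P ≫ A.dStep a) ≫ A.restr P ≫ A.incl P = A.incl P ≫ A.dStep a :=
      comp_restr_incl _ fun c c' h => hP.step a _ c' h c.1.2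
    simpa only [Category.assoc] using this
  halt_comm := rfl

variable (A P)

/-- Two copies of a state set, glued along a subset. -/
abbrev doubleStates : StateSet.{u} D :=
  ⟨A.Q.carrier ⊕ {q // ¬ P q}, Sum.elim A.Q.ty fun q => A.Q.ty q.1⟩

def doubleLeft : A.Q ⟶ A.doubleStates P where
  toFun c := some ⟨Sum.inl c.1, c.2⟩
  isTransformation q := Or.inr ⟨Sum.inl q, _, D.isUpdate_id _, fun _ => rfl⟩

open Classical in
noncomputable def doubleRight : A.Q ⟶ A.doubleStates P where
  toFun c := if h : P c.1 then some ⟨Sum.inl c.1, c.2⟩ else some ⟨Sum.inr ⟨c.1, h⟩, c.2⟩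
  isTransformation q := by
    by_cases h : P q
    · exact Or.inr ⟨Sum.inl q, _, D.isUpdate_id _, fun d => dif_pos h⟩
    · exact Or.inr ⟨Sum.inr ⟨q, h⟩, _, D.isUpdate_id _, fun d => dif_neg h⟩

def doubleFold : A.doubleStates P ⟶ A.Q where
  toFun
    | ⟨Sum.inl q, d⟩ => some ⟨q, d⟩
    | ⟨Sum.inr q, d⟩ => some ⟨q.1, d⟩
  isTransformation
    | Sum.inl q => Or.inr ⟨q, _, D.isUpdate_id _, fun _ => rfl⟩
    | Sum.inr q => Or.inr ⟨q.1, _, D.isUpdate_id _, fun _ => rfl⟩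

/-- A run in the second copy returns to the shared states as soon as it enters `P`. -/
noncomputable def doubleStep (a : S) : A.doubleStates P ⟶ A.doubleStates P where
  toFun
    | ⟨Sum.inl q, d⟩ => (A.dStep a ≫ A.doubleLeft P).toFun ⟨q, d⟩
    | ⟨Sum.inr q, d⟩ => (A.dStep a ≫ A.doubleRight P).toFun ⟨q.1, d⟩
  isTransformation
    | Sum.inl q => (A.dStep a ≫ A.doubleLeft P).isTransformation q
    | Sum.inr q => (A.dStep a ≫ A.doubleRight P).isTransformation q.1

/-- Two copies of a transducer, glued along a closed set of control states. -/
noncomputable abbrev double : Transducer D S where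
  Q := A.doubleStates P
  dInit := A.dInit ≫ A.doubleLeft P
  dStep := A.doubleStep P
  dHalt := A.doubleFold P ≫ A.dHalt

variable {A P}

theorem doubleRight_toFun {c : A.Q.Config} (h : P c.1) :
    (A.doubleRight P).toFun c = (A.doubleLeft P).toFun c := dif_pos h

theorem doubleRight_toFun_of_not {c : A.Q.Config} (h : ¬ P c.1) :
    (A.doubleRight P).toFun c = some ⟨Sum.inr ⟨c.1, h⟩, c.2⟩ := dif_neg h

theorem comp_doubleLeft_toFun {Q : StateSet.{u} D} (f : Q ⟶ A.Q) {c : Q.Config}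
    (h : ∀ c', f.toFun c = some c' → P c'.1) :
    (f ≫ A.doubleRight P).toFun c = (f ≫ A.doubleLeft P).toFun c := by
  simp only [comp_toFun]
  cases hc : f.toFun c with
  | none => rfl
  | some c' => exact doubleRight_toFun (h c' hc)

variable (A P) in
noncomputable def doubleLeftHom : A ⟶ A.double P where
  map := A.doubleLeft P
  init_comm := rfl
  step_comm _ := hom_ext fun _ => rfl
  halt_comm := hom_ext fun _ => rfl

/-- Closedness is what makes this commute: from a shared state the double moves in the left copy,
which agrees with the right one only if the target is shared too. -/
noncomputable def IsClosed.doubleRightHom (hP : A.IsClosed P) : A ⟶ A.double P where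
  map := A.doubleRight P
  init_comm := hom_ext fun c => comp_doubleLeft_toFun _ fun c' => hP.init c c'
  step_comm a := by
    refine hom_ext fun c => ?_
    by_cases h : P c.1
    · rw [comp_doubleLeft_toFun _ fun c' hc => hP.step a c c' hc h]
      rw [comp_toFun (A.doubleRight P), doubleRight_toFun h]
      rfl
    · rw [comp_toFun (A.doubleRight P), doubleRight_toFun_of_not h]
      rfl
  halt_comm := by
    refine hom_ext fun c => ?_
    by_cases h : P c.1
    · rw [comp_toFun, doubleRight_toFun h]
      rfl
    · rw [comp_toFun, doubleRight_toFun_of_not h]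
      rfl

/-- The two embeddings agree on `P` only, so whatever equalizes them lands in `P`. -/
theorem of_comp_double_eq {Q : StateSet.{u} D} {f : Q ⟶ A.Q}
    (h : f ≫ A.doubleLeft P = f ≫ A.doubleRight P) {c : Q.Config} {c' : A.Q.Config}
    (hc : f.toFun c = some c') : P c'.1 := by
  by_contra hP
  have := congrArg (fun g : Q ⟶ A.doubleStates P => g.toFun c) h
  simp only [comp_toFun, hc, Option.bind_some] at this
  rw [doubleRight_toFun_of_not hP] at this
  cases this

end Restriction

end Transducer

variable {φ : List S → Option (D.Dom D.halt)}

/-- The restriction of a transducer to a closed set of states is a strong subobject. -/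
theorem strongMono_inclHom {B X : Realizer φ} {P : B.transducer.Q.carrier → Prop}
    (hP : B.transducer.IsClosed P) (hX : X.transducer = B.transducer.restrict P) :
    ∃ m : X ⟶ B, StrongMono m := by
  obtain ⟨X, hXφ⟩ := X
  obtain ⟨B, hBφ⟩ := B
  dsimp only at hX hP P
  subst hX
  let m : (⟨B.restrict P, hXφ⟩ : Realizer φ) ⟶ (⟨B, hBφ⟩ : Realizer φ) := hP.inclHom
  have hm : Mono m := by
    constructor
    intro Z g h hgh
    have h1 : g.map ≫ B.incl P = h.map ≫ B.incl P := congrArg Transducer.Hom.map hgh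
    have h2 := congrArg (· ≫ B.restr P) h1
    simp only [Category.assoc, Transducer.incl_restr, Category.comp_id] at h2
    exact Transducer.Hom.ext h2
  have hlift : ∀ (Y Z : Realizer φ) (z : Y ⟶ Z) (_ : Epi z) (t : Y ⟶ ⟨B.restrict P, hXφ⟩)
      (b : Z ⟶ ⟨B, hBφ⟩) (sq : CommSq t z m b), sq.HasLift := by
    intro Y Z z hz t b sq
    -- The two embeddings of `B` in its double agree after `m`. Cancelling the epi `z` shows that
    -- they agree after `b`, so `b` takes values in `P`, and its corestriction is the lift.
    let W : Realizer φ := ⟨B.double P, ((B.doubleLeftHom P).transduction_eq).symm.trans hBφ⟩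
    let i₁ : (⟨B, hBφ⟩ : Realizer φ) ⟶ W := B.doubleLeftHom P
    let i₂ : (⟨B, hBφ⟩ : Realizer φ) ⟶ W := hP.doubleRightHom
    have hi : m ≫ i₁ = m ≫ i₂ := by
      refine Transducer.Hom.ext (hom_ext fun c => ?_)
      exact (Transducer.comp_doubleLeft_toFun (B.incl P)
        (by rintro _ ⟨⟩; exact c.1.2)).symm
    have hb : b ≫ i₁ = b ≫ i₂ := by
      rw [← cancel_epi z, ← Category.assoc, ← Category.assoc, ← sq.w, Category.assoc, hi,
        Category.assoc]
    have hb' : ∀ c c', b.map.toFun c = some c' → P c'.1 := fun c c' hc =>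
      Transducer.of_comp_double_eq (congrArg Transducer.Hom.map hb) hc
    have hbm : b.map ≫ B.restr P ≫ B.incl P = b.map := Transducer.comp_restr_incl _ hb'
    have hcan : ∀ {Q : StateSet D} (f g : Q ⟶ B.subStates P),
        f ≫ B.incl P = g ≫ B.incl P → f = g := fun f g h => by
      have := congrArg (· ≫ B.restr P) h
      simpa only [Category.assoc, Transducer.incl_restr, Category.comp_id] using this
    have hm1 := hP.inclHom.init_comm
    have hm2 := hP.inclHom.step_comm
    have hm3 := hP.inclHom.halt_comm
    change (B.restrict P).dInit ≫ B.incl P = _ at hm1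
    change ∀ a, (B.restrict P).dStep a ≫ B.incl P = B.incl P ≫ _ at hm2
    change _ = B.incl P ≫ _ at hm3
    let l : Z ⟶ (⟨B.restrict P, hXφ⟩ : Realizer φ) :=
      { map := b.map ≫ B.restr P
        init_comm := by
          refine hcan _ _ ?_
          rw [Category.assoc, Category.assoc, hbm, hm1, b.init_comm]
        step_comm := fun a => by
          refine hcan _ _ ?_
          rw [Category.assoc, Category.assoc, hbm, Category.assoc, Category.assoc, hm2,
            ← Category.assoc (B.restr P), ← Category.assoc b.map, hbm, b.step_comm]
        halt_comm := by
          rw [hm3, Category.assoc, ← Category.assoc (B.restr P), ← Category.assoc b.map, hbm,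
            b.halt_comm] }
    have hl : l ≫ m = b := Transducer.Hom.ext (by
      change (b.map ≫ B.restr P) ≫ B.incl P = b.map
      rw [Category.assoc, hbm])
    refine ⟨⟨⟨l, ?_, hl⟩⟩⟩
    rw [← cancel_mono m, Category.assoc, hl, sq.w]
  exact ⟨m, StrongMono.mk' (f := m) hlift⟩

/-- If the reachable configurations of `B` are mapped, by a transformation, to the corresponding
configurations of a transducer `M` with only reachable states, then `M` is a subquotient of `B`. -/
theorem isSubquotient_of_config_eq (hD : D.Rigid) {M B : Realizer φ}
    (hM : ∀ r, M.transducer.Reachable r) (h : B.transducer.Q ⟶ M.transducer.Q)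
    (hh : ∀ w, M.transducer.config w = (B.transducer.config w).bind h.toFun) :
    IsSubquotient M B := by
  have hP := B.transducer.isClosed_reachable
  let X : Realizer φ := ⟨B.transducer.restrict B.transducer.Reachable,
    hP.inclHom.transduction_eq.trans B.realizes⟩
  let i : X.transducer.Q ⟶ B.transducer.Q := B.transducer.incl B.transducer.Reachable
  have hi1 : X.transducer.dInit ≫ i = _ := hP.inclHom.init_comm
  have hi2 : ∀ a, X.transducer.dStep a ≫ i = i ≫ _ := hP.inclHom.step_comm
  have hi3 : X.transducer.dHalt = i ≫ _ := hP.inclHom.halt_comm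
  let e : X ⟶ M :=
    { map := i ≫ h
      init_comm := by
        rw [← Category.assoc, hi1]
        refine hom_ext ?_
        rintro ⟨⟨⟩, d⟩
        rw [D.eq_initDatum d]
        have := hh []
        rw [Transducer.config_nil, Transducer.config_nil] at this
        exact this.symm
      step_comm := fun a => by
        rw [← Category.assoc, hi2, Category.assoc, Category.assoc]
        refine hom_ext ?_
        rintro ⟨⟨q, w, d₀, hw⟩, d⟩
        -- The hypothesis on configurations gives commutation only at the reached datum `d₀`;
        -- rigidity extends it to every datum of the state.
        refine hD.eq_on_state (i ≫ B.transducer.dStep a ≫ h) (i ≫ h ≫ M.transducer.dStep a)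
          (q := ⟨q, w, d₀, hw⟩) (d := d₀) ?_ d
        have h1 := hh (w ++ [a])
        rw [Transducer.config_concat, Transducer.config_concat, hh, hw] at h1
        exact h1.symm
      halt_comm := by
        rw [hi3, Category.assoc]
        refine hom_ext ?_
        rintro ⟨⟨q, w, d₀, hw⟩, d⟩
        refine hD.eq_on_state (i ≫ B.transducer.dHalt) (i ≫ h ≫ M.transducer.dHalt)
          (q := ⟨q, w, d₀, hw⟩) (d := d₀) ?_ d
        have h1 := congrFun (B.realizes.trans M.realizes.symm) w
        rw [Transducer.transduction_eq, Transducer.transduction_eq, hh, hw, Option.bind_some,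
          Option.bind_some] at h1
        refine Option.map_injective ?_ h1
        rintro ⟨⟨⟩, x⟩ ⟨⟨⟩, y⟩ hxy
        exact congrArg _ hxy }
  refine ⟨X, ⟨e, ⟨fun {Z} g g' hg => ?_⟩⟩, strongMono_inclHom hP rfl⟩
  refine Transducer.Hom.ext (hom_ext ?_)
  rintro ⟨r, d⟩
  obtain ⟨w, d₀, hw⟩ := hM r
  refine hD.eq_on_state g.map g'.map (d := d₀) ?_ d
  have h1 := hh w
  rw [hw] at h1
  -- Each state of `M` is reached by some word, and the configuration of `B` after that word maps
  -- there. So `g` and `g'` agree at one datum of every state, which suffices by rigidity.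
  obtain ⟨⟨q, d₁⟩, hq, hq'⟩ := Option.bind_eq_some_iff.1 h1.symm
  let c : X.transducer.Q.Config := ⟨⟨q, w, d₁, hq⟩, d₁⟩
  have h2 : ((i ≫ h) ≫ g.map).toFun c = ((i ≫ h) ≫ g'.map).toFun c :=
    congrArg (fun k : X ⟶ Z => k.map.toFun c) hg
  have h3 : (i ≫ h).toFun c = some ⟨r, d₀⟩ := hq'
  rw [comp_toFun (i ≫ h), comp_toFun (i ≫ h), h3] at h2
  exact h2

end STT

/-! ### Reduced transducers over the leaf substitution algebra are minimal. -/

namespace STT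

variable {Γ : Type v} {rank : Γ → ℕ} {S : Type u}

namespace Term

variable {V : Type*} {X : Type}

theorem subst_injective {n : ℕ} {d : Term rank (Fin n)} (hd : d.vars = List.finRange n) :
    Function.Injective (d.subst : (Fin n → Term rank X) → Term rank X) := by
  intro f g h
  funext x
  exact (d.subst_congr_iff.1 h) x (by rw [hd]; exact List.mem_finRange x)

/-- The universal property of the greatest common prefix. The tuple is linear because `d` lists its
placeholders in order, so the variables of `d.subst w` are those of the components of `w` one after
another. Cancelling `d` then relates the families. -/
theorem exists_isLinearTuple {n m : ℕ} {F : V → Option (Fin n → Term rank X)}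
    {G : V → Option (Fin m → Term rank X)} (hG : IsIrreducible G) {d : Term rank (Fin n)}
    {d' : Term rank (Fin m)} (hd : d.vars = List.finRange n) (hd' : d'.vars = List.finRange m)
    (H : ∀ v, (F v).map d.subst = (G v).map d'.subst) :
    ∃ w : Fin n → Term rank (Fin m), IsLinearTuple w ∧ d.subst w = d' ∧
      ∀ v, F v = (G v).map fun γ i => (w i).subst γ := by
  obtain ⟨w, rfl⟩ := exists_subst_eq hG (fun _ => d') (by rw [hd]; exact List.nodup_finRange n) H
  refine ⟨w, ?_, rfl, fun v => ?_⟩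
  · rw [IsLinearTuple, ← hd', vars_subst, hd]
  · refine Option.map_injective (subst_injective hd) ((H v).trans ?_)
    rw [Option.map_map]
    congr 1
    funext γ
    exact subst_subst _ _ _

/-- Equal codes have equally many placeholders, and linearity fixes their names; hence `d` and `d'`
coincide and can be cancelled. -/
theorem sigma_eq_of_irreducible {n m : ℕ} {F : V → Option (Fin n → Term rank X)}
    {G : V → Option (Fin m → Term rank X)} (hF : IsIrreducible F) (hG : IsIrreducible G)
    {d : Term rank (Fin n)} {d' : Term rank (Fin m)} (hd : d.vars = List.finRange n)
    (hd' : d'.vars = List.finRange m) (H : ∀ v, (F v).map d.subst = (G v).map d'.subst) :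
    (⟨n, F⟩ : Σ n, V → Option (Fin n → Term rank X)) = ⟨m, G⟩ := by
  have hc := code_eq_of_irreducible hF hG H
  have hn := length_vars_eq hc
  rw [hd, hd', List.length_finRange, List.length_finRange] at hn
  subst hn
  obtain rfl := eq_of_code_eq hc (hd.trans hd'.symm)
  rw [funext fun v => Option.map_injective (subst_injective hd) (H v)]

end Term

/-- Every placeholder occurs in the datum, so the substituted tuple can be read off from the result.
-/
theorem leafAlgebra_rigid (rank : Γ → ℕ) : (leafAlgebra rank).Rigid := by
  rintro α β g g' ⟨w, -, hw⟩ ⟨w', -, hw'⟩ d h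
  have h1 := (hw d).symm.trans ((congrArg Subtype.val h).trans (hw' d))
  obtain rfl := Term.subst_injective d.2.1 h1
  funext t
  exact Subtype.ext ((hw t).trans (hw' t).symm)

/-- The update specified by a linear tuple. -/
def applyTuple {α β : Option ℕ} {w : Fin (arity α) → Term rank (Fin (arity β))}
    (h : IsLinearTuple w ∧ β ≠ none) (t : leafDom rank α) : leafDom rank β :=
  ⟨t.1.subst w, by rw [Term.vars_subst, t.2.1]; exact h.1, fun hβ => (h.2 hβ).elim⟩

theorem specifies_applyTuple {α β : Option ℕ} {w : Fin (arity α) → Term rank (Fin (arity β))}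
    (h : IsLinearTuple w ∧ β ≠ none) : Specifies w (applyTuple h) :=
  ⟨h.1, fun _ => rfl⟩

variable {Q Q' : StateSet.{u} (leafAlgebra rank)}

/-- A target state together with a linear tuple that specifies an update. -/
abbrev Move (rank : Γ → ℕ) (α : Option ℕ) (Q' : StateSet.{u} (leafAlgebra rank)) : Type (max u v) :=
  Σ r : Q'.carrier, {w : Fin (arity α) → Term rank (Fin (arity (Q'.ty r))) //
    IsLinearTuple w ∧ (Q'.ty r : Option ℕ) ≠ none}

def Move.apply {α : Option ℕ} (x : Move rank α Q') (d : leafDom rank α) : Q'.Config :=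
  ⟨x.1, applyTuple x.2.2 d⟩

/-- The transformation that makes the given moves. -/
def ofMoves (f : ∀ q : Q.carrier, Option (Move rank (Q.ty q) Q')) : Q ⟶ Q' where
  toFun c := (f c.1).map fun x => x.apply c.2
  isTransformation q := by
    cases h : f q with
    | none => exact Or.inl fun d => by simp only [h]; rfl
    | some x =>
      exact Or.inr ⟨x.1, applyTuple x.2.2, ⟨x.2.1, specifies_applyTuple x.2.2⟩,
        fun d => by simp only [h]; rfl⟩

theorem ofMoves_toFun (f : ∀ q : Q.carrier, Option (Move rank (Q.ty q) Q')) (q : Q.carrier)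
    (d : leafDom rank (Q.ty q)) :
    (ofMoves f).toFun ⟨q, d⟩ = (f q).map fun x => x.apply d := rfl

/-- The ground term in a final configuration. -/
def outTerm (c : (haltSpace.{u} (leafAlgebra rank)).Config) : Term rank (Fin 0) := c.2.1

theorem exists_output (f : Q ⟶ haltSpace (leafAlgebra rank)) (q : Q.carrier) :
    ∃ o : Option (Fin (arity (Q.ty q)) → Term rank (Fin 0)), ∀ d : leafDom rank (Q.ty q),
      (f.toFun ⟨q, d⟩).map outTerm = o.map d.1.subst := by
  rcases f.isTransformation q with h | ⟨r, g, ⟨w, -, hw⟩, h⟩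
  · exact ⟨none, fun d => congrArg (Option.map outTerm) (h d)⟩
  · exact ⟨some w, fun d =>
      (congrArg (Option.map outTerm) (h d)).trans (congrArg some (hw d))⟩

namespace Transducer

variable (A B M : Transducer (leafAlgebra rank) S)

/-- The tuple of ground terms that is substituted in the data at state `q` when a word is read from
there to the end. -/
def IsResidual (q : A.Q.carrier)
    (F : List S → Option (Fin (arity (A.Q.ty q)) → Term rank (Fin 0))) : Prop :=
  ∀ v (d : leafDom rank (A.Q.ty q)),
    ((A.run v ≫ A.dHalt).toFun ⟨q, d⟩).map outTerm = (F v).map d.1.subst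

theorem exists_isResidual (q : A.Q.carrier) : ∃ F, A.IsResidual q F := by
  choose F hF using fun v => exists_output (A.run v ≫ A.dHalt) q
  exact ⟨F, hF⟩

/-- The outputs of a transducer, as terms. -/
def output (w : List S) : Option (Term rank (Fin 0)) :=
  (A.transduction w).map fun t : leafDom rank (some 0) => t.1

theorem output_append (w v : List S) : A.output (w ++ v) =
    (A.config w).bind fun c => ((A.run v ≫ A.dHalt).toFun c).map outTerm := by
  rw [output, transduction_eq, config_append]
  cases A.config w with
  | none => rfl
  | some c =>
    simp only [Option.bind_some, comp_toFun]
    cases ((A.run v).toFun c).bind A.dHalt.toFun <;> rfl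

variable {A B M}

theorem output_append_of_config_eq {q : A.Q.carrier} {F} (hF : A.IsResidual q F) {w : List S}
    {d : leafDom rank (A.Q.ty q)} (h : A.config w = some ⟨q, d⟩) (v : List S) :
    A.output (w ++ v) = (F v).map d.1.subst := by
  rw [output_append, h]
  exact hF v d

theorem output_append_of_config_eq_none {w : List S} (h : A.config w = none) (v : List S) :
    A.output (w ++ v) = none := by
  rw [output_append, h]
  rfl

/-- All states are reachable, and their residuals are irreducible and distinct. -/
structure IsReduced (M : Transducer (leafAlgebra rank) S)
    (G : ∀ r, List S → Option (Fin (arity (M.Q.ty r)) → Term rank (Fin 0))) : Prop where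
  ty_ne_none : ∀ r, (M.Q.ty r : Option ℕ) ≠ none
  reachable : ∀ r, M.Reachable r
  isResidual : ∀ r, M.IsResidual r (G r)
  isIrreducible : ∀ r, Term.IsIrreducible (G r)
  injective : Function.Injective fun r =>
    (⟨_, G r⟩ : Σ n, List S → Option (Fin n → Term rank (Fin 0)))

theorem IsReduced.exists_output {G} (h : M.IsReduced G) {w : List S} {c : M.Q.Config}
    (hw : M.config w = some c) : ∃ v t, M.output (w ++ v) = some t := by
  obtain ⟨v, f, hv⟩ := (h.isIrreducible c.1).exists_eq_some
  exact ⟨v, _, by rw [output_append_of_config_eq (h.isResidual c.1) hw, hv]; rfl⟩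

/-- One word `w₀` that reaches `q` determines the move; that it serves all other words reaching `q`
follows because they share the residual `F` of `q`. -/
theorem IsReduced.exists_move {G} (h : M.IsReduced G) (hB : M.output = B.output)
    (q : B.Q.carrier) : ∃ o : Option (Move rank (B.Q.ty q) M.Q), ∀ w d,
      B.config w = some ⟨q, d⟩ → M.config w = o.map fun x => x.apply d := by
  by_cases hq : B.Reachable q
  swap
  · exact ⟨none, fun w d hw => (hq ⟨w, d, hw⟩).elim⟩
  obtain ⟨w₀, d₀, hw₀⟩ := hq
  obtain ⟨F, hF⟩ := B.exists_isResidual q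
  cases hM : M.config w₀ with
  | none =>
    -- If `M` is undefined after `w₀`, then `F` is nowhere defined, so no word reaching `q` can be
    -- continued to an output, whereas every configuration reached by `M` can.
    refine ⟨none, fun w d hw => ?_⟩
    by_contra hne
    obtain ⟨c, hc⟩ := Option.ne_none_iff_exists'.1 hne
    obtain ⟨v, t, ht⟩ := h.exists_output hc
    have h1 := output_append_of_config_eq_none hM v
    rw [hB, output_append_of_config_eq hF hw₀, Option.map_eq_none_iff] at h1
    rw [hB, output_append_of_config_eq hF hw, h1] at ht
    cases ht
  | some c =>
    obtain ⟨r, e⟩ := c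
    have H : ∀ v, (F v).map d₀.1.subst = (G r v).map e.1.subst := fun v => by
      rw [← output_append_of_config_eq hF hw₀, ← hB,
        output_append_of_config_eq (h.isResidual r) hM]
    obtain ⟨x, hx, hxd, hxF⟩ := Term.exists_isLinearTuple (h.isIrreducible r) d₀.2.1 e.2.1 H
    refine ⟨some ⟨r, x, hx, h.ty_ne_none r⟩, fun w d hw => ?_⟩
    -- Thus `d.subst x` is the greatest common prefix of the outputs after `w`, with remainder `G
    -- r`. By uniqueness and distinctness of residuals, `M` is in state `r` with this datum.
    have H' : ∀ v, M.output (w ++ v) = (G r v).map (d.1.subst x).subst := fun v => by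
      rw [hB, output_append_of_config_eq hF hw, hxF, Option.map_map]
      congr 1
      funext γ
      exact (Term.subst_subst _ _ _).symm
    obtain ⟨v, f, hv⟩ := (h.isIrreducible r).exists_eq_some
    cases hc : M.config w with
    | none =>
      have h1 := H' v
      rw [output_append_of_config_eq_none hc, hv] at h1
      cases h1
    | some c =>
      obtain ⟨s, e'⟩ := c
      have H2 : ∀ v, (G s v).map e'.1.subst = (G r v).map (d.1.subst x).subst := fun v => by
        rw [← H', output_append_of_config_eq (h.isResidual s) hc]
      have hv : (d.1.subst x).vars = List.finRange (arity (M.Q.ty r)) := by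
        rw [Term.vars_subst, d.2.1]
        exact hx
      obtain rfl : s = r := h.injective (Term.sigma_eq_of_irreducible (h.isIrreducible s)
        (h.isIrreducible r) e'.2.1 hv H2)
      have h3 := Term.eq_of_code_eq (Term.code_eq_of_irreducible (h.isIrreducible s)
        (h.isIrreducible s) H2) (e'.2.1.trans hv.symm)
      exact congrArg some (congrArg (Sigma.mk s) (Subtype.ext h3))

theorem IsReduced.exists_hom {G} (h : M.IsReduced G) (hB : M.output = B.output) :
    ∃ f : B.Q ⟶ M.Q, ∀ w, M.config w = (B.config w).bind f.toFun := by
  choose o ho using h.exists_move hB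
  refine ⟨ofMoves o, fun w => ?_⟩
  cases hw : B.config w with
  | none =>
    by_contra hne
    obtain ⟨c, hc⟩ := Option.ne_none_iff_exists'.1 hne
    obtain ⟨v, t, ht⟩ := h.exists_output hc
    rw [hB, output_append_of_config_eq_none hw] at ht
    cases ht
  | some c => exact ho c.1 w c.2 hw

/-- Reduced transducers are minimal. -/
theorem IsReduced.algebraicallyMinimal
    {φ : List S → Option ((leafAlgebra rank).Dom (leafAlgebra rank).halt)} {M : Realizer φ} {G}
    (h : M.transducer.IsReduced G) : AlgebraicallyMinimal M := by
  intro B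
  have hB : M.transducer.output = B.transducer.output := by
    unfold output
    rw [M.realizes, B.realizes]
  obtain ⟨f, hf⟩ := h.exists_hom hB
  exact isSubquotient_of_config_eq (leafAlgebra_rigid rank) h.reachable f hf

end Transducer

end STT

/-! ### Construction of the minimal transducer from the residuals. -/

namespace STT

variable {Γ : Type v} {rank : Γ → ℕ} {S : Type u}

/-- A partial family of tuples of ground terms. -/
abbrev Family (rank : Γ → ℕ) (S : Type u) : Type (max u v) :=
  Σ n, List S → Option (Fin n → Term rank (Fin 0))

/-- The family `x` is what remains of `χ` when the greatest common prefix is removed. -/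
def Family.IsNormalForm (χ : List S → Option (Term rank (Fin 0))) (x : Family rank S) : Prop :=
  Term.IsIrreducible x.2 ∧
    ∃ p : leafDom rank (some x.1), ∀ v, χ v = (x.2 v).map p.1.subst

theorem Family.exists_isNormalForm (χ : List S → Option (Term rank (Fin 0)))
    (h : ∃ v t, χ v = some t) : ∃ x, IsNormalForm χ x := by
  obtain ⟨n, p, G, hp, hG, hχ⟩ := Term.exists_linear_irreducible χ h
  exact ⟨⟨n, G⟩, hG, ⟨p, hp, by rintro ⟨⟩⟩, hχ⟩

theorem Family.IsNormalForm.unique {χ : List S → Option (Term rank (Fin 0))} {x y : Family rank S}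
    (hx : x.IsNormalForm χ) (hy : y.IsNormalForm χ) : x = y := by
  obtain ⟨hx, p, hp⟩ := hx
  obtain ⟨hy, q, hq⟩ := hy
  exact Term.sigma_eq_of_irreducible hx hy p.2.1 q.2.1 fun v => (hp v).symm.trans (hq v)

/-- The words after which some output is possible. -/
abbrev Live (ψ : List S → Option (Term rank (Fin 0))) : Type u :=
  {w : List S // ∃ v t, ψ (w ++ v) = some t}

noncomputable def Live.normalForm (ψ : List S → Option (Term rank (Fin 0))) (w : Live ψ) :
    Family rank S :=
  (Family.exists_isNormalForm (fun v => ψ (w.1 ++ v)) w.2).choose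

namespace Minimal

open Transducer

variable (ψ : List S → Option (Term rank (Fin 0)))

/-- The states of the minimal transducer: classes of live words with the same residual. -/
abbrev State : Type u := Quotient (Setoid.ker (Live.normalForm ψ))

noncomputable def family (q : State ψ) : Family rank S := Setoid.kerLift (Live.normalForm ψ) q

theorem family_injective : Function.Injective (family ψ) :=
  Setoid.kerLift_injective _

noncomputable abbrev states : StateSet.{u} (leafAlgebra rank) :=
  ⟨State ψ, fun q => some (family ψ q).1⟩

variable {ψ}

theorem isNormalForm_mk (w : Live ψ) :
    (family ψ (Quotient.mk _ w)).IsNormalForm fun v => ψ (w.1 ++ v) :=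
  (Family.exists_isNormalForm (fun v => ψ (w.1 ++ v)) w.2).choose_spec

theorem isIrreducible_family (q : State ψ) : Term.IsIrreducible (family ψ q).2 := by
  induction q using Quotient.inductionOn with
  | h w => exact (isNormalForm_mk w).1

/-- The move `o` turns a partial family of tuples into the residual of its target. -/
def IsMove {n : ℕ} (F : List S → Option (Fin n → Term rank (Fin 0)))
    (o : Option (Σ r : State ψ, {w : Fin n → Term rank (Fin (family ψ r).1) //
      IsLinearTuple w})) : Prop :=
  ∀ v, F v = o.bind fun x => ((family ψ x.1).2 v).map fun γ i => (x.2.1 i).subst γ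

/-- The move goes to the class of `w`, with the tuple that extends the prefix `d` to the greatest
one; it is undefined if `w` is dead. `IsMove` mentions only `F`, so the choice of the word `w` is
irrelevant afterwards. -/
theorem exists_isMove {n : ℕ} (F : List S → Option (Fin n → Term rank (Fin 0)))
    {d : Term rank (Fin n)} (hd : d.vars = List.finRange n) (w : List S)
    (h : ∀ v, ψ (w ++ v) = (F v).map d.subst) :
    ∃ o : Option (Σ r : State ψ, {w : Fin n → Term rank (Fin (family ψ r).1) //
      IsLinearTuple w}), IsMove F o := by
  by_cases hw : ∃ v t, ψ (w ++ v) = some t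
  · obtain ⟨hG, p, hp⟩ := isNormalForm_mk (⟨w, hw⟩ : Live ψ)
    obtain ⟨x, hx, -, hF⟩ := Term.exists_isLinearTuple hG hd p.2.1
      fun v => (h v).symm.trans (hp v)
    exact ⟨some ⟨Quotient.mk _ ⟨w, hw⟩, x, hx⟩, hF⟩
  · refine ⟨none, fun v => ?_⟩
    by_contra hne
    obtain ⟨f, hf⟩ := Option.ne_none_iff_exists'.1 hne
    exact hw ⟨v, _, by rw [h, hf]; rfl⟩

theorem exists_isMove_init :
    ∃ o : Option (Σ r : State ψ, {w : Fin 1 → Term rank (Fin (family ψ r).1) //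
      IsLinearTuple w}), IsMove (fun v => (ψ v).map fun t _ => t) o :=
  exists_isMove _ (d := Term.var 0) rfl [] fun v => by
    rw [Option.map_map]
    exact Option.map_id'.symm

theorem exists_isMove_step (q : State ψ) (a : S) :
    ∃ o : Option (Σ r : State ψ, {w : Fin (family ψ q).1 → Term rank (Fin (family ψ r).1) //
      IsLinearTuple w}), IsMove (fun v => (family ψ q).2 (a :: v)) o := by
  induction q using Quotient.inductionOn with
  | h w =>
    obtain ⟨-, p, hp⟩ := isNormalForm_mk w
    exact exists_isMove _ p.2.1 (w.1 ++ [a]) fun v => by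
      rw [List.append_assoc]
      exact hp (a :: v)

theorem isLinearTuple_ground {n : ℕ} (w : Fin n → Term rank (Fin 0)) : IsLinearTuple w := by
  rw [IsLinearTuple, List.finRange_zero, List.eq_nil_iff_forall_not_mem]
  exact fun i => i.elim0

variable (ψ)

/-- The minimal transducer. -/
noncomputable def transducer : Transducer (leafAlgebra rank) S where
  Q := states ψ
  dInit := ofMoves fun _ => (exists_isMove_init (ψ := ψ)).choose.map
    fun x => (⟨x.1, x.2.1, x.2.2, Option.some_ne_none _⟩ : Move rank none (states ψ))
  dStep a := ofMoves fun q => (exists_isMove_step q a).choose.map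
    fun x => (⟨x.1, x.2.1, x.2.2, Option.some_ne_none _⟩ : Move rank (some (family ψ q).1) (states ψ))
  dHalt := ofMoves fun q => ((family ψ q).2 []).map
    fun γ => (⟨PUnit.unit, γ, isLinearTuple_ground γ, by rintro ⟨⟩⟩ :
      Move rank (some (family ψ q).1) (haltSpace (leafAlgebra rank)))

/-- Induction on the word: `IsMove` is precisely the recursion that residuals satisfy along a
letter. -/
theorem isResidual (q : State ψ) : (transducer ψ).IsResidual q (family ψ q).2 := by
  intro v
  induction v generalizing q with
  | nil =>
    intro d
    simp only [run, Category.id_comp]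
    change Option.map _ (Option.map _ (Option.map _ ((family ψ q).2 []))) = _
    cases (family ψ q).2 [] <;> rfl
  | cons a v ih =>
    intro d
    simp only [run, Category.assoc]
    refine Eq.trans ?_ (congrArg (Option.map d.1.subst)
      ((exists_isMove_step q a).choose_spec v).symm)
    change ((Option.map _ (Option.map _ (exists_isMove_step q a).choose)).bind _).map _ = _
    cases (exists_isMove_step q a).choose with
    | none => rfl
    | some x =>
      refine (ih x.1 (applyTuple (β := some (family ψ x.1).1) ⟨x.2.2, Option.some_ne_none _⟩ d)).trans ?_
      change Option.map (d.1.subst x.2.1).subst ((family ψ x.1).2 v) =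
        Option.map d.1.subst (Option.map _ ((family ψ x.1).2 v))
      cases (family ψ x.1).2 v with
      | none => rfl
      | some γ => exact congrArg some (Term.subst_subst _ _ _)

theorem output_eq : (transducer ψ).output = ψ := by
  funext v
  have h := (exists_isMove_init (ψ := ψ)).choose_spec v
  have h2 : (transducer ψ).config [] = (exists_isMove_init (ψ := ψ)).choose.map fun x =>
      ⟨x.1, applyTuple (α := none) (β := some (family ψ x.1).1) ⟨x.2.2, Option.some_ne_none _⟩
        (leafAlgebra rank).initDatum⟩ := by
    rw [config_nil]
    change Option.map _ (Option.map _ (exists_isMove_init (ψ := ψ)).choose) = _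
    cases (exists_isMove_init (ψ := ψ)).choose <;> rfl
  cases ho : (exists_isMove_init (ψ := ψ)).choose with
  | none =>
    rw [ho] at h h2
    rw [← List.nil_append v, output_append_of_config_eq_none h2]
    exact (Option.map_eq_none_iff.1 h).symm
  | some x =>
    rw [ho] at h h2
    conv_lhs => rw [← List.nil_append v]
    rw [output_append_of_config_eq (isResidual ψ x.1) h2]
    have h3 := congrArg (Option.map fun f : Fin 1 → Term rank (Fin 0) => f 0) h
    rw [Option.map_map, Option.bind_some, Option.map_map] at h3
    exact h3.symm.trans Option.map_id'

theorem isReduced : (transducer ψ).IsReduced fun q => (family ψ q).2 where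
  ty_ne_none _ := by rintro ⟨⟩
  isResidual := isResidual ψ
  isIrreducible := isIrreducible_family
  injective _ _ h := family_injective ψ h
  reachable q := by
    induction q using Quotient.inductionOn with
    | h w =>
      cases hc : (transducer ψ).config w.1 with
      | none =>
        obtain ⟨v, t, ht⟩ := w.2
        have h := congrFun (output_eq ψ) (w.1 ++ v)
        rw [output_append_of_config_eq_none hc, ht] at h
        cases h
      | some c =>
        obtain ⟨q, d⟩ := c
        -- The state reached after `w` carries a normal form of the outputs after `w`; by uniqueness
        -- it is the class of `w`.
        have hq : (family ψ q).IsNormalForm fun v => ψ (w.1 ++ v) :=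
          ⟨isIrreducible_family q, d, fun v =>
            (congrFun (output_eq ψ) (w.1 ++ v)).symm.trans
              (output_append_of_config_eq (isResidual ψ q) hc v)⟩
        obtain rfl := family_injective ψ (hq.unique (isNormalForm_mk w))
        exact ⟨w.1, d, hc⟩

end Minimal

/-- Every transduction is realized by a reduced transducer. -/
theorem exists_isReduced
    (φ : List S → Option ((leafAlgebra rank).Dom (leafAlgebra rank).halt)) :
    ∃ (M : Transducer (leafAlgebra rank) S) (G : _), M.IsReduced G ∧ M.transduction = φ := by
  let ψ : List S → Option (Term rank (Fin 0)) := fun w =>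
    (φ w).map fun t : leafDom rank (some 0) => t.1
  refine ⟨Minimal.transducer ψ, _, Minimal.isReduced ψ, funext fun w => ?_⟩
  exact Option.map_injective Subtype.val_injective (congrFun (Minimal.output_eq ψ) w)

end STT

/-! ### The calculus of codes, and its agreement with transformations. -/

namespace STT

section Codes

variable {Γ : Type v}

/-- The number of placeholders in a code. -/
def holes (l : List (Option Γ)) : ℕ := l.countP Option.isNone

/-- Substitution of a list of codes for the placeholders of a code. -/
def fill : List (Option Γ) → TupleCode Γ → List (Option Γ)
  | [], _ => []
  | none :: l, w => w.headD [] ++ fill l w.tail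
  | some g :: l, w => some g :: fill l w

/-- Substitution of a tuple for the placeholders of a tuple. -/
def compose : TupleCode Γ → TupleCode Γ → TupleCode Γ
  | [], _ => []
  | l :: x, w => fill l w :: compose x (w.drop (holes l))

theorem holes_append (l l' : List (Option Γ)) : holes (l ++ l') = holes l + holes l' :=
  List.countP_append

theorem fill_append (l l' : List (Option Γ)) (w : TupleCode Γ) :
    fill (l ++ l') w = fill l w ++ fill l' (w.drop (holes l)) := by
  induction l generalizing w with
  | nil => rfl
  | cons o l ih =>
    cases o with
    | none =>
      simp only [List.cons_append, fill, ih, List.append_assoc]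
      simp [holes]
    | some g =>
      simp only [List.cons_append, fill, ih]
      simp [holes]

theorem fill_fill (l : List (Option Γ)) (w x : TupleCode Γ) :
    fill (fill l w) x = fill l (compose w x) := by
  induction l generalizing w x with
  | nil => rfl
  | cons o l ih =>
    cases o with
    | none =>
      cases w with
      | nil => simpa [fill, compose] using ih [] x
      | cons y w => simp only [fill, compose, fill_append, List.headD_cons, List.tail_cons, ih]
    | some g => simp only [fill, ih]

theorem holes_fill (l : List (Option Γ)) (w : TupleCode Γ) :
    holes (fill l w) = holes (w.take (holes l)).flatten := by
  induction l generalizing w with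
  | nil => simp [holes, fill]
  | cons o l ih =>
    cases o with
    | none =>
      cases w with
      | nil => simpa [fill, holes] using ih []
      | cons y w =>
        have : holes (none :: l) = holes l + 1 := by simp [holes]
        rw [this, List.take_succ_cons, List.flatten_cons, fill, holes_append, holes_append]
        simp only [List.headD_cons, List.tail_cons, ih]
    | some g =>
      have h1 : ∀ l' : List (Option Γ), holes (some g :: l') = holes l' := by simp [holes]
      rw [h1, fill, h1, ih]

theorem drop_compose (n : ℕ) (w x : TupleCode Γ) :
    (compose w x).drop n = compose (w.drop n) (x.drop (holes (w.take n).flatten)) := by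
  induction n generalizing w x with
  | zero => simp [holes]
  | succ n ih =>
    cases w with
    | nil => simp [compose]
    | cons y w =>
      simp only [compose, List.drop_succ_cons, ih, List.take_succ_cons, List.flatten_cons,
        holes_append, List.drop_drop]

/-- This holds for arbitrary lists, well formed or not, because a missing entry counts as the empty
code throughout. Hence the simulation argument for codes needs no well-formedness. -/
theorem compose_assoc (x w y : TupleCode Γ) :
    compose (compose x w) y = compose x (compose w y) := by
  induction x generalizing w y with
  | nil => rfl
  | cons l x ih => simp only [compose, fill_fill, ih, holes_fill, drop_compose]

/-- The description of a transformation on a state. -/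
abbrev CodeMove (Γ : Type v) : Type v := Option (ℕ × TupleCode Γ)

/-- The effect of a move after a tuple. -/
def after (x : TupleCode Γ) (o : CodeMove Γ) : CodeMove Γ :=
  o.map fun p => (p.1, compose x p.2)

/-- The composition of a move with the moves of the next transformation. -/
def andThen (o : CodeMove Γ) (f : ℕ → CodeMove Γ) : CodeMove Γ :=
  o.bind fun p => after p.2 (f p.1)

theorem after_after (x y : TupleCode Γ) (o : CodeMove Γ) :
    after x (after y o) = after (compose x y) o := by
  cases o with
  | none => rfl
  | some p => simp [after, compose_assoc]

theorem andThen_after (x : TupleCode Γ) (o : CodeMove Γ) (f : ℕ → CodeMove Γ) :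
    andThen (after x o) f = after x (andThen o f) := by
  cases o with
  | none => rfl
  | some p => exact (after_after _ _ _).symm

variable {m : ℕ}

def codeStep (c : Code Γ m) (a : Fin m) (k : ℕ) : CodeMove Γ :=
  c.2[k]?.bind fun s => s.2.1 a

def codeHalt (c : Code Γ m) (k : ℕ) : CodeMove Γ :=
  c.2[k]?.bind fun s => s.2.2.map fun x => (0, x)

def codeRun (c : Code Γ m) (o : CodeMove Γ) (w : List (Fin m)) : CodeMove Γ :=
  w.foldl (fun o a => andThen o (codeStep c a)) o

def codeOutput (c : Code Γ m) (w : List (Fin m)) : CodeMove Γ :=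
  andThen (codeRun c c.1 w) (codeHalt c)

/-- The number of placeholders of the data at a state. -/
def width (c : Code Γ m) (k : ℕ) : ℕ :=
  (c.2[k]?.map fun s => arity s.1).getD 0

/-- `[none]` is the code of a bare placeholder, so the run starts with the identity update at `k`.
-/
def codeResidual (c : Code Γ m) (k : ℕ) (w : List (Fin m)) : CodeMove Γ :=
  andThen (codeRun c (some (k, List.replicate (width c k) [none])) w) (codeHalt c)

end Codes

variable {Γ : Type v} {rank : Γ → ℕ}

namespace Term

variable {X Y : Type}

theorem holes_code (t : Term rank X) : holes t.code = t.vars.length := t.length_vars.symm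

/-- The surplus entries `w` are what the later siblings consume in the induction. -/
theorem fill_code (t : Term rank X) (f : X → Term rank Y) (w : TupleCode Γ) :
    fill t.code ((t.vars.map fun x => (f x).code) ++ w) = (t.subst f).code := by
  induction t generalizing w with
  | var x => simp [code, vars, fill, subst]
  | node g ts ih =>
    simp only [code, vars, subst, fill, List.cons.injEq, true_and]
    revert ts
    generalize rank g = n
    intro ts ih
    induction n generalizing w with
    | zero => simp [fill]
    | succ n ih' =>
      simp only [List.ofFn_succ, List.flatten_cons, List.map_append, List.append_assoc,
        fill_append, ih 0]
      rw [List.drop_left' (by rw [List.length_map, holes_code])]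
      rw [ih' _ (fun i => ts i.succ) (fun i => ih i.succ)]

end Term

theorem IsLinearTuple.flatten_eq {a b : ℕ} {w : Fin a → Term rank (Fin b)}
    (h : IsLinearTuple w) : (List.ofFn fun i => (w i).vars).flatten = List.finRange b := by
  rw [← h, List.flatMap_def, List.ofFn_eq_map]

/-- Linearity makes the components of `x` use consecutive segments of `w`, which is how `compose`
distributes its second argument. -/
theorem tupleCode_subst {a b c : ℕ} {x : Fin a → Term rank (Fin b)} (h : IsLinearTuple x)
    (w : Fin b → Term rank (Fin c)) :
    tupleCode (fun i => (x i).subst w) = compose (tupleCode x) (tupleCode w) := by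
  have key : ∀ (a : ℕ) (x : Fin a → Term rank (Fin b)) (y : TupleCode Γ),
      compose (tupleCode x) (((List.ofFn fun i => (x i).vars).flatten.map
        fun j => (w j).code) ++ y) = tupleCode fun i => (x i).subst w := by
    intro a
    induction a with
    | zero => intro x y; simp [tupleCode, compose]
    | succ a ih =>
      intro x y
      have := ih (fun i => x i.succ) y
      simp only [tupleCode] at this ⊢
      simp only [List.ofFn_succ, compose, List.flatten_cons, List.map_append, List.append_assoc,
        Term.fill_code]
      rw [List.drop_left' (by rw [List.length_map, Term.holes_code]), this]
  have := key a x []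
  rw [h.flatten_eq, List.append_nil, ← List.ofFn_eq_map] at this
  exact this.symm

theorem tupleCode_injective {a b : ℕ} {x y : Fin a → Term rank (Fin b)} (hx : IsLinearTuple x)
    (hy : IsLinearTuple y) (h : tupleCode x = tupleCode y) : x = y := by
  have hc := congrFun (List.ofFn_injective h)
  have := flatten_ofFn_inj_of_length (fun i => Term.length_vars_eq (hc i))
    (hx.flatten_eq.trans hy.flatten_eq.symm)
  exact funext fun i => Term.eq_of_code_eq (hc i) (congrFun this i)

section Describes

variable {Q Q' Q'' : StateSet.{u} (leafAlgebra rank)} {num : Q'.carrier → ℕ}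
  {num' : Q''.carrier → ℕ}

theorem exists_describes (num : Q'.carrier → ℕ) (f : Q ⟶ Q') (q : Q.carrier) :
    ∃ o, Describes num f q o := by
  rcases f.isTransformation q with h | ⟨r, g, ⟨t, ht⟩, h⟩
  · exact ⟨none, h⟩
  · exact ⟨some (num r, tupleCode t), r, t, g, rfl, rfl, ht, h⟩

theorem Describes.comp {f : Q ⟶ Q'} {g : Q' ⟶ Q''} {q : Q.carrier} {o : CodeMove Γ}
    {O : ℕ → CodeMove Γ} (hf : Describes num f q o) (hg : ∀ r, Describes num' g r (O (num r))) :
    Describes num' (f ≫ g) q (andThen o O) := by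
  cases o with
  | none => exact fun d => (congrArg (Option.bind · g.toFun) (hf d))
  | some p =>
    obtain ⟨k, x⟩ := p
    obtain ⟨r, t, i, hr, rfl, ht, hi⟩ := hf
    have h2 := hg r
    rw [hr] at h2
    have h3 : andThen (some (k, tupleCode t)) O = after (tupleCode t) (O k) := rfl
    rw [h3]
    cases hO : O k with
    | none =>
      rw [hO] at h2
      exact fun d => (congrArg (Option.bind · g.toFun) (hi d)).trans (h2 _)
    | some p' =>
      rw [hO] at h2
      obtain ⟨s, t', i', hs, ht'', ht', hi'⟩ := h2
      refine ⟨s, fun x => (t x).subst t', i' ∘ i, hs, ?_, ⟨?_, fun d => ?_⟩, fun d => ?_⟩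
      · rw [tupleCode_subst ht.1, ht'']
      · have h1 := ht.1
        have h2 := ht'.1
        unfold IsLinearTuple at *
        simp only [Term.vars_subst]
        rw [← List.flatMap_assoc, h1, h2]
      · rw [Function.comp_apply, ht'.2, ht.2, Term.subst_subst]
      · exact (congrArg (Option.bind · g.toFun) (hi d)).trans (hi' _)

/-- The datum `d` is essential: on a state with empty domain, as may occur when there are no
constants, every description is vacuously compatible with being undefined. -/
theorem Describes.unique {f : Q ⟶ Q'} {q : Q.carrier} {o o' : CodeMove Γ}
    (h : Describes num f q o) (h' : Describes num f q o') (d : leafDom rank (Q.ty q)) :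
    o = o' := by
  cases o with
  | none =>
    cases o' with
    | none => rfl
    | some p =>
      obtain ⟨r, t, i, hr, hc, ht, hi⟩ := h'
      cases (h d).symm.trans (hi d)
  | some p =>
    obtain ⟨r, t, i, hr, hc, ht, hi⟩ := h
    cases o' with
    | none => cases (hi d).symm.trans (h' d)
    | some p' =>
      obtain ⟨r', t', i', hr', hc', ht', hi'⟩ := h'
      have h1 := (hi d).symm.trans (hi' d)
      obtain ⟨rfl, h1⟩ := Sigma.mk.inj (Option.some.inj h1)
      have h2 := congrArg Subtype.val (eq_of_heq h1)
      have h3 := (ht.2 d).symm.trans (h2.trans (ht'.2 d))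
      obtain rfl := Term.subst_injective d.2.1 h3
      exact congrArg some (Prod.ext (hr.symm.trans hr') (hc.symm.trans hc'))

theorem describes_id (num : Q.carrier → ℕ) (q : Q.carrier) :
    Describes num (𝟙 Q) q (some (num q, List.replicate (arity (Q.ty q)) [none])) := by
  refine ⟨q, Term.var, id, rfl, ?_, ⟨?_, fun t => (t.1.subst_var).symm⟩, fun _ => rfl⟩
  · exact List.ofFn_const _ _
  · simp [IsLinearTuple, Term.vars]

end Describes

section Presents

variable {m : ℕ} {c : Code Γ m} {A : Transducer (leafAlgebra rank) (Fin m)}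

/-- Every transducer with finitely many states has a finite presentation. -/
theorem exists_presents (A : Transducer (leafAlgebra rank) (Fin m)) [Finite A.Q.carrier] :
    ∃ c, Presents c A := by
  obtain ⟨n, ⟨e⟩⟩ := Finite.exists_equiv_fin A.Q.carrier
  let num : A.Q.carrier → ℕ := fun q => e q
  obtain ⟨i, hi⟩ := exists_describes num A.dInit PUnit.unit
  choose s hs using fun q a => exists_describes num (A.dStep a) q
  choose h hh using fun q => exists_describes (fun _ => 0) A.dHalt q
  let L : List (Option ℕ × (Fin m → Option (ℕ × TupleCode Γ)) × Option (TupleCode Γ)) :=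
    List.ofFn fun j : Fin n => (A.Q.ty (e.symm j), s (e.symm j), (h (e.symm j)).map Prod.snd)
  have hL : n = L.length := List.length_ofFn.symm
  refine ⟨(i, L), e.trans (finCongr hL), hi, fun q => ?_⟩
  have hq : L.get ((e.trans (finCongr hL)) q) =
      ((A.Q.ty q : Option ℕ), s q, (h q).map Prod.snd) := by
    simp [L]
    rfl
  dsimp only
  rw [hq]
  refine ⟨rfl, hs q, ?_⟩
  have h1 := hh q
  have h2 : ((h q).map Prod.snd).map (fun x => (0, x)) = h q := by
    cases ho : h q with
    | none => rfl
    | some p =>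
      rw [ho] at h1
      obtain ⟨_, _, _, h3, _⟩ := h1
      exact congrArg some (Prod.ext h3 rfl)
  dsimp only
  rw [h2]
  exact h1

/-- The description `c` presents `A` with the numbering `e` of the states. -/
structure PresentsBy (c : Code Γ m) (A : Transducer (leafAlgebra rank) (Fin m))
    (e : A.Q.carrier ≃ Fin c.2.length) : Prop where
  init : Describes (fun r => (e r : ℕ)) A.dInit PUnit.unit c.1
  getElem? : ∀ q, ∃ s, c.2[(e q : ℕ)]? = some s ∧ s.1 = A.Q.ty q
  step : ∀ q a, Describes (fun r => (e r : ℕ)) (A.dStep a) q (codeStep c a (e q))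
  halt : ∀ q, Describes (fun _ => 0) A.dHalt q (codeHalt c (e q))

theorem Presents.exists_presentsBy (h : Presents c A) : ∃ e, PresentsBy c A e := by
  obtain ⟨e, hi, h⟩ := h
  have hg : ∀ q, c.2[(e q : ℕ)]? = some (c.2.get (e q)) := fun q => by simp
  refine ⟨e, hi, fun q => ⟨_, hg q, (h q).1.symm⟩, fun q a => ?_, fun q => ?_⟩
  · rw [codeStep, hg]
    exact (h q).2.1 a
  · rw [codeHalt, hg]
    exact (h q).2.2

namespace PresentsBy

variable {e : A.Q.carrier ≃ Fin c.2.length} (h : PresentsBy c A e)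

include h

theorem width_eq (q : A.Q.carrier) : width c (e q) = arity (A.Q.ty q) := by
  obtain ⟨s, hs, hs'⟩ := h.getElem? q
  rw [width, hs, ← hs']
  rfl

theorem describes_run {Q : StateSet (leafAlgebra rank)} {f : Q ⟶ A.Q} {q : Q.carrier}
    {o : CodeMove Γ} (hf : Describes (fun r => (e r : ℕ)) f q o) (w : List (Fin m)) :
    Describes (fun r => (e r : ℕ)) (f ≫ A.run w) q (codeRun c o w) := by
  induction w generalizing f o with
  | nil =>
    simp only [Transducer.run, Category.comp_id]
    exact hf
  | cons a w ih =>
    simp only [Transducer.run, ← Category.assoc]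
    exact ih (hf.comp fun r => h.step r a)

theorem describes_output (w : List (Fin m)) :
    Describes (fun _ => 0) ((A.dInit ≫ A.run w) ≫ A.dHalt) PUnit.unit (codeOutput c w) :=
  (h.describes_run h.init w).comp h.halt

theorem describes_residual (q : A.Q.carrier) (w : List (Fin m)) :
    Describes (fun _ => 0) (A.run w ≫ A.dHalt) q (codeResidual c (e q) w) := by
  have := (h.describes_run (describes_id (fun r => (e r : ℕ)) q) w).comp h.halt
  rw [Category.id_comp, ← h.width_eq] at this
  exact this

theorem codeResidual_eq {q : A.Q.carrier} {F} (hF : A.IsResidual q F)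
    (d : leafDom rank (A.Q.ty q)) (w : List (Fin m)) :
    codeResidual c (e q) w = (F w).map fun γ => (0, tupleCode γ) := by
  have h1 := hF w d
  have h2 := h.describes_residual q w
  cases ho : codeResidual c (e q) w with
  | none =>
    rw [ho] at h2
    have h3 := h1.symm.trans (congrArg (Option.map outTerm) (h2 d))
    rw [Option.map_eq_none_iff.1 h3]
    rfl
  | some p =>
    rw [ho] at h2
    obtain ⟨r, t, g, hp, ht, hg, hd⟩ := h2
    have h3 := h1.symm.trans ((congrArg (Option.map outTerm) (hd d)).trans
      (congrArg some (hg.2 d)))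
    obtain ⟨γ, h4, h5⟩ := Option.map_eq_some_iff.1 h3
    obtain rfl := Term.subst_injective d.2.1 h5
    rw [h4]
    exact congrArg some (Prod.ext hp.symm ht.symm)

end PresentsBy

/-- Equal codes of linear tuples of the same format come from equal tuples, hence specify the same
update of the initial datum. -/
theorem output_eq_of_codeOutput_eq {c' : Code Γ m} {B : Transducer (leafAlgebra rank) (Fin m)}
    {e : A.Q.carrier ≃ Fin c.2.length} {e' : B.Q.carrier ≃ Fin c'.2.length}
    (h : PresentsBy c A e) (h' : PresentsBy c' B e') (hc : codeOutput c = codeOutput c') :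
    A.transduction = B.transduction := by
  funext w
  have h1 := h.describes_output w
  have h2 := h'.describes_output w
  rw [Category.assoc] at h1 h2
  unfold Transducer.transduction
  rw [hc] at h1
  cases ho : codeOutput c' w with
  | none =>
    rw [ho] at h1 h2
    exact congrArg (Option.map (β := leafDom rank (some 0)) fun c => c.2) ((h1 _).trans (h2 _).symm)
  | some p =>
    rw [ho] at h1 h2
    obtain ⟨⟨⟩, t, g, -, ht, hg, hd⟩ := h1
    obtain ⟨⟨⟩, t', g', -, ht', hg', hd'⟩ := h2
    have htt : t = t' := tupleCode_injective hg.1 hg'.1 (ht.trans ht'.symm)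
    subst htt
    have hgg : g = g' := funext fun d => Subtype.ext ((hg.2 d).trans (hg'.2 d).symm)
    subst hgg
    exact congrArg (Option.map (β := leafDom rank (some 0)) fun c => c.2) ((hd _).trans (hd' _).symm)

end Presents

end STT

/-! ### Finite certificates, and their soundness. -/

namespace STT

section Checks

variable {Γ : Type v} {m : ℕ}

/-- Two moves are related if both are undefined, or if the second one is the effect of the first one
and of a move that `L` associates with its target. -/
def Related (L : List (ℕ × CodeMove Γ)) (o o' : CodeMove Γ) : Prop :=
  (o = none ∧ o' = none) ∨
    ∃ p ∈ L, o.map Prod.fst = some p.1 ∧ o' = o.bind fun x => after x.2 p.2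

/-- The relation given by `L` is a simulation between two finite descriptions. -/
def Simulates (L : List (ℕ × CodeMove Γ)) (c c' : Code Γ m) : Prop :=
  Related L c.1 c'.1 ∧ ∀ p ∈ L,
    (∀ a, Related L (codeStep c a p.1) (andThen p.2 (codeStep c' a))) ∧
      codeHalt c p.1 = andThen p.2 (codeHalt c')

theorem Related.after {L : List (ℕ × CodeMove Γ)} {o o' : CodeMove Γ} (h : Related L o o')
    (x : TupleCode Γ) : Related L (after x o) (after x o') := by
  rcases h with ⟨rfl, rfl⟩ | ⟨p, hp, h, rfl⟩
  · exact Or.inl ⟨rfl, rfl⟩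
  · refine Or.inr ⟨p, hp, ?_, ?_⟩
    · rw [← h, STT.after, Option.map_map]
      rfl
    · cases o with
      | none => rfl
      | some y => exact after_after _ _ _

/-- The invariant of the run: the second move is the first one followed by the move that `L`
attaches to its target. Associativity carries it past the tuple that has accumulated so far. -/
theorem Simulates.related_run {L : List (ℕ × CodeMove Γ)} {c c' : Code Γ m}
    (h : Simulates L c c') {o o' : CodeMove Γ} (ho : Related L o o') (w : List (Fin m)) :
    Related L (codeRun c o w) (codeRun c' o' w) := by
  induction w generalizing o o' with
  | nil => exact ho
  | cons a w ih =>
    refine ih ?_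
    rcases ho with ⟨rfl, rfl⟩ | ⟨p, hp, h1, rfl⟩
    · exact Or.inl ⟨rfl, rfl⟩
    · cases o with
      | none => cases h1
      | some y =>
        have h0 : y.1 = p.1 := Option.some.inj h1
        have h2 : andThen (Option.bind (some y) fun x => after x.2 p.2) (codeStep c' a) =
            after y.2 (andThen p.2 (codeStep c' a)) := andThen_after _ _ _
        have h3 := ((h.2 p hp).1 a).after y.2
        rw [← h0, ← h2] at h3
        exact h3

theorem Simulates.codeOutput_eq {L : List (ℕ × CodeMove Γ)} {c c' : Code Γ m}
    (h : Simulates L c c') : codeOutput c = codeOutput c' := by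
  funext w
  unfold codeOutput
  rcases h.related_run h.1 w with ⟨h1, h2⟩ | ⟨p, hp, h1, h2⟩
  · rw [h1, h2]
    rfl
  · rw [h2]
    cases ho : codeRun c c.1 w with
    | none =>
      rw [ho] at h1
      cases h1
    | some y =>
      rw [ho] at h1
      have h3 : y.1 = p.1 := Option.some.inj h1
      have h4 : andThen (Option.bind (some y) fun x => after x.2 p.2) (codeHalt c') =
        after y.2 (andThen p.2 (codeHalt c')) := andThen_after _ _ _
      rw [h4, ← (h.2 p hp).2, ← h3]
      rfl

section WellFormed

variable [DecidableEq Γ]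

/-- The number of terms that are written in a code, one after another, if the ranks of the symbols
are as in the table `T`. -/
def height (T : List (Γ × ℕ)) : List (Option Γ) → Option ℕ
  | [] => some 0
  | none :: l => (height T l).map Nat.succ
  | some g :: l => (height T l).bind fun h => (T.lookup g).bind fun k =>
      if k ≤ h then some (h - k + 1) else none

/-- Placeholders are unnamed in codes, so linearity reduces to their total number. -/
def IsTupleCode (T : List (Γ × ℕ)) (a b : ℕ) (x : TupleCode Γ) : Prop :=
  x.length = a ∧ (∀ l ∈ x, height T l = some 1) ∧ holes x.flatten = b

def IsMoveCode (T : List (Γ × ℕ)) (c : Code Γ m) (a : ℕ) (o : CodeMove Γ) : Prop :=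
  ∀ p, o = some p → p.1 < c.2.length ∧ IsTupleCode T a (width c p.1) p.2

/-- All tuples in the description are linear tuples of the right type. -/
def WellFormed (T : List (Γ × ℕ)) (c : Code Γ m) : Prop :=
  IsMoveCode T c 1 c.1 ∧ ∀ k < c.2.length, (c.2[k]?.bind fun s => s.1) ≠ none ∧
    (∀ a, IsMoveCode T c (width c k) (codeStep c a k)) ∧
      ∀ p, codeHalt c k = some p → IsTupleCode T (width c k) 0 p.2

end WellFormed

/-- The root of a component of the output tuple. -/
def rootAt (c : Code Γ m) (k i : ℕ) (w : List (Fin m)) : Option (Option Γ) :=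
  (codeResidual c k w).bind fun p => p.2[i]?.bind List.head?

/-- The words in `W` show that a description is the description of a reduced transducer. -/
def IsReducedCode (W : List (List (Fin m))) (c : Code Γ m) : Prop :=
  ∀ k < c.2.length,
    (∃ w ∈ W, (codeRun c c.1 w).map Prod.fst = some k) ∧
    (∃ w ∈ W, codeResidual c k w ≠ none) ∧
    (∀ i < width c k, ∃ w ∈ W, ∃ w' ∈ W,
      rootAt c k i w ≠ none ∧ rootAt c k i w' ≠ none ∧ rootAt c k i w ≠ rootAt c k i w') ∧
    ∀ k' < c.2.length, k = k' ∨ ∃ w ∈ W, codeResidual c k w ≠ codeResidual c k' w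

end Checks

variable {Γ : Type v} {rank : Γ → ℕ} {m : ℕ}

section Parsing

variable [DecidableEq Γ] {T : List (Γ × ℕ)}

theorem mem_of_lookup_eq_some {g : Γ} {k : ℕ} (h : T.lookup g = some k) : (g, k) ∈ T := by
  induction T with
  | nil => cases h
  | cons p T ih =>
    obtain ⟨g', k'⟩ := p
    rw [List.lookup_cons] at h
    split at h
    · rename_i hg
      obtain rfl : g = g' := by simpa using hg
      cases h
      exact List.mem_cons_self
    · exact List.mem_cons_of_mem _ (ih h)

theorem lookup_map_eq_some {gs : List Γ} {g : Γ} (h : g ∈ gs) :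
    (gs.map fun g => (g, rank g)).lookup g = some (rank g) := by
  induction gs with
  | nil => cases h
  | cons g' gs ih =>
    rw [List.map_cons, List.lookup_cons]
    split
    · rename_i hg
      obtain rfl : g = g' := by simpa using hg
      rfl
    · rename_i hg
      refine ih ((List.mem_cons.1 h).resolve_left ?_)
      rintro rfl
      simp at hg

/-- Polish notation is parsed from the right with a stack: a symbol of rank `k` takes the top `k`
terms and pushes one. -/
theorem exists_terms_of_height_eq (hT : ∀ p ∈ T, rank p.1 = p.2) {l : List (Option Γ)} {n : ℕ}
    (h : height T l = some n) :
    ∃ ts : List (Term rank Unit), ts.length = n ∧ l = (ts.map Term.code).flatten := by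
  induction l generalizing n with
  | nil =>
    cases h
    exact ⟨[], rfl, rfl⟩
  | cons o l ih =>
    cases o with
    | none =>
      obtain ⟨k, hk, rfl⟩ := Option.map_eq_some_iff.1 h
      obtain ⟨ts, rfl, rfl⟩ := ih hk
      exact ⟨Term.var () :: ts, rfl, rfl⟩
    | some g =>
      obtain ⟨k, hk, h⟩ := Option.bind_eq_some_iff.1 h
      obtain ⟨j, hj, h⟩ := Option.bind_eq_some_iff.1 h
      split at h
      · rename_i hjk
        cases h
        obtain ⟨ts, rfl, rfl⟩ := ih hk
        obtain rfl : rank g = j := hT _ (mem_of_lookup_eq_some hj)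
        refine ⟨Term.node g (fun i => ts[i]) :: ts.drop (rank g), by simp, ?_⟩
        have h1 : (List.ofFn fun i : Fin (rank g) => (ts[i]).code) =
            (ts.take (rank g)).map Term.code := by
          apply List.ext_getElem
          · simp [hjk]
          · intro i h1 h2
            simp
        simp only [List.map_cons, List.flatten_cons, Term.code, h1, List.cons_append,
          ← List.flatten_append, ← List.map_append, List.take_append_drop]
      · cases h

theorem height_code_append {X : Type} (t : Term rank X)
    (hT : ∀ g, some g ∈ t.code → T.lookup g = some (rank g)) (l : List (Option Γ)) :
    height T (t.code ++ l) = (height T l).map Nat.succ := by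
  induction t generalizing l with
  | var x => rfl
  | node g ts ih =>
    have hg := hT g (by simp [Term.code])
    have key : ∀ (n : ℕ) (ts : Fin n → Term rank X)
        (_ : ∀ i l, height T ((ts i).code ++ l) = (height T l).map Nat.succ),
        height T ((List.ofFn fun i => (ts i).code).flatten ++ l) = (height T l).map (· + n) := by
      intro n
      induction n with
      | zero => intro ts _; simp
      | succ n ih' =>
        intro ts h
        simp only [List.ofFn_succ, List.flatten_cons, List.append_assoc]
        rw [h, ih' (fun i => ts i.succ) fun i => h i.succ, Option.map_map]
        rfl
    have h1 := key (rank g) ts fun i => ih i fun g' hg' => hT g' (by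
      simp only [Term.code, List.mem_cons, List.mem_flatten, List.mem_ofFn]
      exact Or.inr ⟨_, ⟨i, rfl⟩, hg'⟩)
    simp only [Term.code, List.cons_append, height, h1, hg]
    cases height T l <;> simp

theorem IsTupleCode.exists_tuple (hT : ∀ p ∈ T, rank p.1 = p.2) {a b : ℕ} {x : TupleCode Γ}
    (h : IsTupleCode T a b x) :
    ∃ t : Fin a → Term rank (Fin b), IsLinearTuple t ∧ tupleCode t = x := by
  obtain ⟨rfl, h1, h2⟩ := h
  have : ∀ i : Fin x.length, ∃ t : Term rank Unit, t.code = x.get i := by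
    intro i
    obtain ⟨ts, ht, hx⟩ := exists_terms_of_height_eq hT (h1 _ (x.get_mem i))
    obtain ⟨t, rfl⟩ := List.length_eq_one_iff.1 ht
    exact ⟨t, by simpa using hx.symm⟩
  choose t ht using this
  -- The parsed terms have anonymous placeholders. These are now numbered from left to right through
  -- the whole tuple, which makes it linear.
  obtain ⟨ls, hls, hf⟩ := exists_flatten_ofFn_eq (fun i => (t i).vars) (List.finRange b) (by
    rw [List.length_finRange, ← h2, holes, List.countP_flatten, List.length_flatten,
      List.map_ofFn]
    congr 1
    apply List.ext_getElem
    · simp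
    · intro i hi hi'
      simp [Term.length_vars, ht])
  choose s hs hs' using fun i => (t i).exists_relabel (ls i) (hls i)
  refine ⟨s, ?_, ?_⟩
  · rw [IsLinearTuple, List.flatMap_def, ← List.ofFn_eq_map, funext hs, hf]
  · rw [tupleCode, funext fun i => (hs' i).trans (ht i)]
    exact List.ofFn_get x

theorem isTupleCode_tupleCode {a b : ℕ} {t : Fin a → Term rank (Fin b)} (h : IsLinearTuple t)
    (hT : ∀ l ∈ tupleCode t, ∀ g, some g ∈ l → T.lookup g = some (rank g)) :
    IsTupleCode T a b (tupleCode t) := by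
  refine ⟨List.length_ofFn, fun l hl => ?_, ?_⟩
  · have h0 := hT l hl
    obtain ⟨i, rfl⟩ := List.mem_ofFn.1 hl
    have := height_code_append (t i) h0 []
    rw [List.append_nil] at this
    rw [this]
    rfl
  · have h1 := congrArg List.length h.flatten_eq
    rw [List.length_flatten, List.map_ofFn, List.length_finRange] at h1
    rw [holes, List.countP_flatten, tupleCode, List.map_ofFn]
    refine Eq.trans ?_ h1
    congr 2
    funext i
    exact ((t i).length_vars).symm

end Parsing

section Soundness

variable {α : Option ℕ} {Q Q' : StateSet.{u} (leafAlgebra rank)}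

def Move.code (num : Q'.carrier → ℕ) (x : Move rank α Q') : ℕ × TupleCode Γ :=
  (num x.1, tupleCode x.2.1)

theorem describes_ofMoves (num : Q'.carrier → ℕ)
    (f : ∀ q : Q.carrier, Option (Move rank (Q.ty q) Q')) (q : Q.carrier) {o : CodeMove Γ}
    (h : o = (f q).map (Move.code num)) : Describes num (ofMoves f) q o := by
  subst h
  cases hf : f q with
  | none => exact fun d => (ofMoves_toFun f q d).trans (by rw [hf]; rfl)
  | some x =>
    exact ⟨x.1, x.2.1, applyTuple x.2.2, rfl, rfl, specifies_applyTuple x.2.2,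
      fun d => (ofMoves_toFun f q d).trans (by rw [hf]; rfl)⟩

theorem WellFormed.exists_presents [DecidableEq Γ] {T : List (Γ × ℕ)}
    (hT : ∀ p ∈ T, rank p.1 = p.2) {c : Code Γ m} (h : WellFormed T c) :
    ∃ M : Transducer (leafAlgebra rank) (Fin m),
      Presents c M ∧ ∀ r, (M.Q.ty r : Option ℕ) ≠ none := by
  let Q : StateSet.{0} (leafAlgebra rank) := ⟨Fin c.2.length, fun k => (c.2.get k).1⟩
  let num : Q.carrier → ℕ := fun r => (r : Fin c.2.length)
  have hg : ∀ k : Fin c.2.length, c.2[(k : ℕ)]? = some (c.2.get k) := fun k => by simp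
  have hw : ∀ k : Fin c.2.length, width c k = arity (c.2.get k).1 := fun k => by
    rw [width, hg]
    rfl
  have hty : ∀ k : Fin c.2.length, (c.2.get k).1 ≠ none := fun k => by
    have := (h.2 k k.2).1
    rw [hg] at this
    exact this
  have hmove : ∀ (α : Option ℕ) (o : CodeMove Γ), IsMoveCode T c (arity α) o →
      ∃ f : Option (Move rank α Q), o = f.map (Move.code num) := by
    intro α o ho
    cases o with
    | none => exact ⟨none, rfl⟩
    | some p =>
      obtain ⟨h1, h2⟩ := ho p rfl
      rw [hw ⟨p.1, h1⟩] at h2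
      obtain ⟨t, ht, hc⟩ := h2.exists_tuple hT
      exact ⟨some ⟨⟨p.1, h1⟩, t, ht, hty _⟩, congrArg some (Prod.ext rfl hc.symm)⟩
  obtain ⟨fi, hi⟩ := hmove none c.1 h.1
  have hs0 : ∀ (k : Fin c.2.length) (a : Fin m), ∃ f : Option (Move rank (c.2.get k).1 Q),
      codeStep c a k = f.map (Move.code num) := fun k a =>
    hmove _ _ (by rw [← hw]; exact (h.2 k k.2).2.1 a)
  choose fs hs using hs0
  have hh0 : ∀ k : Fin c.2.length,
      ∃ f : Option (Move rank (c.2.get k).1 (haltSpace.{0} (leafAlgebra rank))),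
        codeHalt c k = f.map (Move.code fun _ => 0) := by
    intro k
    cases ho : codeHalt c k with
    | none => exact ⟨none, rfl⟩
    | some p =>
      obtain ⟨t, ht, hc⟩ := ((h.2 k k.2).2.2 p ho).exists_tuple hT
      have h0 : p.1 = 0 := by
        rw [codeHalt, hg] at ho
        obtain ⟨y, -, rfl⟩ := Option.map_eq_some_iff.1 ho
        rfl
      have hk := hw k
      revert t
      rw [hk]
      intro t ht hc
      exact ⟨some ⟨PUnit.unit, t, ht, Option.some_ne_none _⟩,
        congrArg some (Prod.ext h0 hc.symm)⟩
  choose fh hh using hh0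
  let M : Transducer (leafAlgebra rank) (Fin m) :=
    { Q := Q
      dInit := ofMoves fun _ => fi
      dStep := fun a => ofMoves fun q => fs q a
      dHalt := ofMoves fun q => fh q }
  have h1 : Describes num M.dInit PUnit.unit c.1 :=
    describes_ofMoves (Q := initSpace (leafAlgebra rank)) num (fun _ => fi) PUnit.unit hi
  refine ⟨M, ⟨Equiv.refl _, h1, fun k => ⟨rfl, fun a => ?_, ?_⟩⟩, hty⟩
  · have := hs k a
    rw [codeStep, hg] at this
    exact describes_ofMoves num (fun q => fs q a) k this
  · have := hh k
    rw [codeHalt, hg] at this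
    exact describes_ofMoves _ (fun q => fh q) k this

end Soundness

section Reduced

variable {c : Code Γ m} {M : Transducer (leafAlgebra rank) (Fin m)}
  {e : M.Q.carrier ≃ Fin c.2.length}

theorem Term.head?_code (t : Term rank (Fin 0)) : t.code.head? = some t.root := by
  cases t with
  | var x => exact x.elim0
  | node g ts => rfl

theorem PresentsBy.rootAt_eq (h : PresentsBy c M e) {q : M.Q.carrier} {F}
    (hF : M.IsResidual q F) (d : leafDom rank (M.Q.ty q)) (i : Fin (arity (M.Q.ty q)))
    (w : List (Fin m)) : rootAt c (e q) i w = (F w).map fun γ => (γ i).root := by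
  rw [rootAt, h.codeResidual_eq hF d]
  cases F w with
  | none => rfl
  | some γ =>
    have : (tupleCode γ)[(i : ℕ)]? = some (γ i).code := by simp [tupleCode]
    simp only [Option.map_some, Option.bind_some, this]
    exact Term.head?_code _

theorem PresentsBy.config_of_codeRun (h : PresentsBy c M e) {w : List (Fin m)} {q : M.Q.carrier}
    (hw : (codeRun c c.1 w).map Prod.fst = some (e q : ℕ)) : ∃ d, M.config w = some ⟨q, d⟩ := by
  obtain ⟨p, hp, hq⟩ := Option.map_eq_some_iff.1 hw
  have h1 := h.describes_run h.init w
  rw [hp] at h1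
  obtain ⟨r, t, g, hr, -, -, hd⟩ := h1
  obtain rfl : r = q := e.injective (Fin.ext (hr.trans hq))
  exact ⟨_, hd _⟩

theorem PresentsBy.codeRun_of_config (h : PresentsBy c M e) {w : List (Fin m)} {x : M.Q.Config}
    (hw : M.config w = some x) : (codeRun c c.1 w).map Prod.fst = some (e x.1 : ℕ) := by
  have h1 := h.describes_run h.init w
  cases ho : codeRun c c.1 w with
  | none =>
    rw [ho] at h1
    cases hw.symm.trans (h1 _)
  | some p =>
    rw [ho] at h1
    obtain ⟨r, t, g, hr, -, -, hd⟩ := h1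
    cases hw.symm.trans (hd _)
    exact congrArg some hr.symm

/-- Soundness of the word list. Reachability also supplies a datum at every state, through which
codes of residuals determine the residuals. -/
theorem PresentsBy.exists_isReduced (h : PresentsBy c M e)
    (hty : ∀ r, (M.Q.ty r : Option ℕ) ≠ none) {W : List (List (Fin m))}
    (hW : IsReducedCode W c) : ∃ G, M.IsReduced G := by
  choose G hG using M.exists_isResidual
  have hreach : ∀ q, M.Reachable q := fun q => by
    obtain ⟨⟨w, -, hw⟩, -⟩ := hW (e q) (e q).2
    exact ⟨w, h.config_of_codeRun hw⟩
  have hd : ∀ q, Nonempty (leafDom rank (M.Q.ty q)) := fun q => by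
    obtain ⟨w, d, -⟩ := hreach q
    exact ⟨d⟩
  refine ⟨G, hty, hreach, hG, fun q => ⟨?_, fun i => ?_⟩, fun q q' hq => ?_⟩
  · obtain ⟨d⟩ := hd q
    obtain ⟨-, ⟨w, -, hw⟩, -⟩ := hW (e q) (e q).2
    rw [h.codeResidual_eq (hG q) d, Ne, Option.map_eq_none_iff] at hw
    exact ⟨w, Option.ne_none_iff_exists'.1 hw⟩
  · obtain ⟨d⟩ := hd q
    obtain ⟨-, -, h1, -⟩ := hW (e q) (e q).2
    rw [h.width_eq] at h1
    obtain ⟨w, -, w', -, h2, h3, h4⟩ := h1 i i.2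
    rw [h.rootAt_eq (hG q) d] at h2 h4
    rw [h.rootAt_eq (hG q) d] at h3 h4
    rw [Ne, Option.map_eq_none_iff] at h2 h3
    obtain ⟨f, hf⟩ := Option.ne_none_iff_exists'.1 h2
    obtain ⟨f', hf'⟩ := Option.ne_none_iff_exists'.1 h3
    rw [hf, hf'] at h4
    exact ⟨w, f, w', f', hf, hf', fun h5 => h4 (congrArg some h5)⟩
  · obtain ⟨d⟩ := hd q
    obtain ⟨d'⟩ := hd q'
    obtain ⟨-, -, -, h1⟩ := hW (e q) (e q).2
    rcases h1 (e q') (e q').2 with h2 | ⟨w, -, hw⟩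
    · exact e.injective (Fin.ext h2)
    · refine (hw ?_).elim
      rw [h.codeResidual_eq (hG q) d, h.codeResidual_eq (hG q') d']
      exact congrArg (fun x : Σ n, List (Fin m) → Option (Fin n → Term rank (Fin 0)) =>
        (x.2 w).map fun γ => (0, tupleCode γ)) hq

theorem eventually_exists_mem {β : Type*} {P : β → Prop} (h : ∃ w, P w) :
    ∀ᶠ s : Finset β in Filter.atTop, ∃ w ∈ s, P w := by
  obtain ⟨w, hw⟩ := h
  filter_upwards [Filter.eventually_ge_atTop {w}] with s hs
  exact ⟨w, hs (Finset.mem_singleton_self w), hw⟩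

/-- There are finitely many conditions, each witnessed by one or two words or by none; a
sufficiently large finite set of words serves them all, hence the filter `atTop` on finite sets. -/
theorem PresentsBy.exists_isReducedCode (h : PresentsBy c M e) {G} (hG : M.IsReduced G) :
    ∃ W, IsReducedCode W c := by
  have : Finite M.Q.carrier := Finite.of_equiv _ e.symm
  have hd : ∀ q, Nonempty (leafDom rank (M.Q.ty q)) := fun q => by
    obtain ⟨w, d, -⟩ := hG.reachable q
    exact ⟨d⟩
  have key : ∀ q, ∀ᶠ s : Finset (List (Fin m)) in Filter.atTop,
      (∃ w ∈ s, (codeRun c c.1 w).map Prod.fst = some (e q : ℕ)) ∧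
      (∃ w ∈ s, codeResidual c (e q) w ≠ none) ∧
      (∀ i : Fin (arity (M.Q.ty q)), ∃ w ∈ s, ∃ w' ∈ s, rootAt c (e q) i w ≠ none ∧
        rootAt c (e q) i w' ≠ none ∧ rootAt c (e q) i w ≠ rootAt c (e q) i w') ∧
      ∀ q', (e q : ℕ) = e q' ∨ ∃ w ∈ s, codeResidual c (e q) w ≠ codeResidual c (e q') w := by
    intro q
    obtain ⟨d⟩ := hd q
    refine (eventually_exists_mem ?_).and ((eventually_exists_mem ?_).and
      ((Filter.eventually_all.2 fun i => ?_).and (Filter.eventually_all.2 fun q' => ?_)))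
    · obtain ⟨w, d, hw⟩ := hG.reachable q
      exact ⟨w, h.codeRun_of_config hw⟩
    · obtain ⟨w, f, hw⟩ := (hG.isIrreducible q).exists_eq_some
      refine ⟨w, ?_⟩
      rw [h.codeResidual_eq (hG.isResidual q) d, hw]
      exact Option.some_ne_none _
    · obtain ⟨w, f, w', f', h1, h2, h3⟩ := (hG.isIrreducible q).exists_root_ne i
      filter_upwards [Filter.eventually_ge_atTop {w, w'}] with s hs
      refine ⟨w, hs (by simp), w', hs (by simp), ?_⟩
      simp only [h.rootAt_eq (hG.isResidual q) d, h1, h2]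
      exact ⟨Option.some_ne_none _, Option.some_ne_none _, fun h4 => h3 (Option.some.inj h4)⟩
    · obtain ⟨d'⟩ := hd q'
      by_cases hq : q = q'
      · exact Filter.Eventually.of_forall fun s => Or.inl (by rw [hq])
      · refine (eventually_exists_mem ?_).mono fun s hs => Or.inr hs
        by_contra! hall
        refine hq (hG.injective ?_)
        simp only [h.codeResidual_eq (hG.isResidual q) d,
          h.codeResidual_eq (hG.isResidual q') d'] at hall
        obtain ⟨w, f, hw⟩ := (hG.isIrreducible q).exists_eq_some
        have hinj : ∀ n, Function.Injective
            fun γ : Fin n → Term rank (Fin 0) => ((0 : ℕ), tupleCode γ) := fun n γ γ' hγ =>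
          tupleCode_injective (Minimal.isLinearTuple_ground γ) (Minimal.isLinearTuple_ground γ')
            (congrArg Prod.snd hγ)
        -- Residuals with equal codes could still have different arities if they were nowhere
        -- defined; irreducibility provides a word with an output tuple, whose length is the arity.
        have harity : arity (M.Q.ty q) = arity (M.Q.ty q') := by
          have h1 := hall w
          rw [hw] at h1
          obtain ⟨f', -, hf'⟩ := Option.map_eq_some_iff.1 h1.symm
          have h2 := congrArg (fun p : ℕ × TupleCode Γ => p.2.length) hf'
          simpa [tupleCode] using h2.symm
        have hgen : ∀ (n n' : ℕ) (F : List (Fin m) → Option (Fin n → Term rank (Fin 0)))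
            (F' : List (Fin m) → Option (Fin n' → Term rank (Fin 0))), n = n' →
            (∀ w, (F w).map (fun γ => ((0 : ℕ), tupleCode γ)) =
              (F' w).map fun γ => ((0 : ℕ), tupleCode γ)) →
            (⟨n, F⟩ : Σ n, List (Fin m) → Option (Fin n → Term rank (Fin 0))) = ⟨n', F'⟩ := by
          rintro n _ F F' rfl hF
          rw [funext fun w => Option.map_injective (hinj n) (hF w)]
        exact hgen _ _ _ _ harity hall
  obtain ⟨s, hs⟩ := (Filter.eventually_all.2 key).exists
  refine ⟨s.toList, fun k hk => ?_⟩
  obtain ⟨q, hq⟩ := e.surjective ⟨k, hk⟩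
  obtain rfl : (e q : ℕ) = k := congrArg Fin.val hq
  obtain ⟨h1, h2, h3, h4⟩ := hs q
  simp only [Finset.mem_toList]
  refine ⟨h1, h2, fun i hi => ?_, fun k' hk' => ?_⟩
  · rw [h.width_eq] at hi
    exact h3 ⟨i, hi⟩
  · obtain ⟨q', hq'⟩ := e.surjective ⟨k', hk'⟩
    obtain rfl : (e q' : ℕ) = k' := congrArg Fin.val hq'
    exact h4 q'

end Reduced

end STT

/-! ### Existence of certificates. -/

namespace STT

variable {Γ : Type v} {rank : Γ → ℕ} {m : ℕ}

theorem Describes.congr {Q Q' : StateSet.{u} (leafAlgebra rank)} {num : Q'.carrier → ℕ}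
    {f f' : Q ⟶ Q'} {q : Q.carrier} (hf : ∀ d, f.toFun ⟨q, d⟩ = f'.toFun ⟨q, d⟩) {o : CodeMove Γ}
    (h : Describes num f q o) : Describes num f' q o := by
  cases o with
  | none => exact fun d => (hf d).symm.trans (h d)
  | some p =>
    obtain ⟨r, t, g, h1, h2, h3, h4⟩ := h
    exact ⟨r, t, g, h1, h2, h3, fun d => (hf d).symm.trans (h4 d)⟩

section Simulation

variable {A M : Transducer (leafAlgebra rank) (Fin m)} {c c' : Code Γ m}
  {e : A.Q.carrier ≃ Fin c.2.length} {e' : M.Q.carrier ≃ Fin c'.2.length}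

/-- Presentations of two transducers are related by a simulation if the reachable configurations are
mapped to each other by a transformation. -/
theorem PresentsBy.exists_simulates (h : PresentsBy c A e) (h' : PresentsBy c' M e')
    (hAM : A.transduction = M.transduction) (f : A.Q ⟶ M.Q)
    (hf : ∀ w, M.config w = (A.config w).bind f.toFun) : ∃ L, Simulates L c c' := by
  classical
  have hfin : Finite A.Q.carrier := Finite.of_equiv _ e.symm
  let num : A.Q.carrier → ℕ := fun q => e q
  let num' : M.Q.carrier → ℕ := fun q => e' q
  have hnum : Function.Injective num := fun q q' hq => e.injective (Fin.ext hq)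
  choose o ho using exists_describes num' f
  let O : ℕ → CodeMove Γ := Function.extend num o fun _ => none
  have hO : ∀ q, O (num q) = o q := hnum.extend_apply _ _
  have hfO : ∀ q, Describes num' f q (O (num q)) := fun q => by
    rw [hO]
    exact ho q
  let R : Finset A.Q.carrier := (Set.toFinite {q | A.Reachable q}).toFinset
  -- The simulation is the graph of `f` on reachable states. Restricting to these matters: elsewhere
  -- `f` need not commute with the transitions, and there might be no datum to identify
  -- descriptions.
  let L : List (ℕ × CodeMove Γ) := R.toList.map fun q => (num q, o q)
  have hrel : ∀ {Q : StateSet (leafAlgebra rank)} (g : Q ⟶ A.Q) (q : Q.carrier)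
      (x x' : CodeMove Γ) (d : leafDom rank (Q.ty q)), Describes num g q x →
      (∀ y, g.toFun ⟨q, d⟩ = some y → A.Reachable y.1) → Describes num' (g ≫ f) q x' →
      Related L x x' := by
    intro Q g q x x' d hx hreach hx'
    obtain rfl := (hx.comp hfO).unique hx' d
    cases x with
    | none => exact Or.inl ⟨rfl, rfl⟩
    | some p =>
      obtain ⟨r, t, i, hr, -, -, hi⟩ := hx
      refine Or.inr ⟨(num r, o r), List.mem_map.2 ⟨r, ?_, rfl⟩, congrArg some hr.symm, ?_⟩
      · simpa [R] using hreach _ (hi d)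
      · rw [← hO, show num r = p.1 from hr]
        rfl
  refine ⟨L, hrel A.dInit PUnit.unit _ _ (leafAlgebra rank).initDatum h.init
    (fun y hy => A.isClosed_reachable.init _ y hy) ?_, ?_⟩
  · refine h'.init.congr fun d => ?_
    rw [(leafAlgebra rank).eq_initDatum d]
    have := hf []
    rwa [Transducer.config_nil, Transducer.config_nil] at this
  · intro p hp
    obtain ⟨q, hq, rfl⟩ := List.mem_map.1 hp
    have hq' : A.Reachable q := by simpa [R] using hq
    obtain ⟨w, d, hw⟩ := hq'
    refine ⟨fun a => hrel (A.dStep a) q _ _ d (h.step q a)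
      (fun y hy => A.isClosed_reachable.step a _ y hy ⟨w, d, hw⟩) ?_, ?_⟩
    · refine ((ho q).comp fun r => h'.step r a).congr fun d' => ?_
      refine (leafAlgebra_rigid rank).eq_on_state (f ≫ M.dStep a) (A.dStep a ≫ f) (d := d) ?_ d'
      have h1 := hf (w ++ [a])
      rw [Transducer.config_concat, Transducer.config_concat, hf, hw] at h1
      exact h1
    · refine (h.halt q).unique (((ho q).comp h'.halt).congr fun d' => ?_) d
      refine (leafAlgebra_rigid rank).eq_on_state (f ≫ M.dHalt) A.dHalt (d := d) ?_ d'
      have h1 := congrFun hAM w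
      rw [Transducer.transduction_eq, Transducer.transduction_eq, hf, hw, Option.bind_some,
        Option.bind_some] at h1
      refine (Option.map_injective ?_ h1).symm
      rintro ⟨⟨⟩, x⟩ ⟨⟨⟩, y⟩ hxy
      exact congrArg _ hxy

end Simulation

section Tables

variable [DecidableEq Γ]

/-- The symbols of a move. -/
def moveSymbols (o : CodeMove Γ) : List Γ :=
  o.elim [] fun p => p.2.flatten.filterMap id

def codeSymbols (c : Code Γ m) : List Γ :=
  moveSymbols c.1 ++ (List.range c.2.length).flatMap fun k =>
    (List.finRange m).flatMap (fun a => moveSymbols (codeStep c a k)) ++ moveSymbols (codeHalt c k)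

variable {c : Code Γ m} {M : Transducer (leafAlgebra rank) (Fin m)}
  {e : M.Q.carrier ≃ Fin c.2.length}

theorem Describes.isTupleCode {Q Q' : StateSet.{u} (leafAlgebra rank)} {num : Q'.carrier → ℕ}
    {f : Q ⟶ Q'} {q : Q.carrier} {o : CodeMove Γ} (h : Describes num f q o) {gs : List Γ}
    (hgs : moveSymbols o ⊆ gs) {p : ℕ × TupleCode Γ} (hp : o = some p) :
    ∃ r, num r = p.1 ∧ IsTupleCode (gs.map fun g => (g, rank g)) (arity (Q.ty q))
      (arity (Q'.ty r)) p.2 := by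
  subst hp
  obtain ⟨r, t, g, hr, ht, hg, -⟩ := h
  refine ⟨r, hr, ?_⟩
  rw [← ht]
  refine isTupleCode_tupleCode hg.1 fun l hl g hgl => lookup_map_eq_some (hgs ?_)
  rw [ht] at hl
  simp only [moveSymbols, Option.elim_some, List.mem_filterMap, List.mem_flatten]
  exact ⟨some g, ⟨l, hl, hgl⟩, rfl⟩

/-- Only the finitely many symbols that occur in the description need entries in the table. -/
theorem PresentsBy.wellFormed (h : PresentsBy c M e) (hty : ∀ r, (M.Q.ty r : Option ℕ) ≠ none) :
    WellFormed ((codeSymbols c).map fun g => (g, rank g)) c := by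
  have hmove : ∀ {Q : StateSet (leafAlgebra rank)} {f : Q ⟶ M.Q} {q : Q.carrier}
      {o : CodeMove Γ}, Describes (fun r => (e r : ℕ)) f q o → moveSymbols o ⊆ codeSymbols c →
      IsMoveCode ((codeSymbols c).map fun g => (g, rank g)) c (arity (Q.ty q)) o := by
    intro Q f q o ho hs p hp
    obtain ⟨r, hr, h1⟩ := ho.isTupleCode hs hp
    rw [← hr, h.width_eq]
    exact ⟨(e r).2, h1⟩
  refine ⟨hmove h.init (List.subset_append_left _ _), fun k hk => ?_⟩
  obtain ⟨q, hq⟩ := e.surjective ⟨k, hk⟩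
  obtain rfl : (e q : ℕ) = k := congrArg Fin.val hq
  have hsub : ∀ x, x ∈ ((List.finRange m).flatMap
      (fun a => moveSymbols (codeStep c a (e q))) ++ moveSymbols (codeHalt c (e q))) →
      x ∈ codeSymbols c := fun x hx =>
    List.mem_append_right _ (List.mem_flatMap.2 ⟨e q, List.mem_range.2 hk, hx⟩)
  refine ⟨?_, fun a => ?_, fun p hp => ?_⟩
  · obtain ⟨s, hs, hs'⟩ := h.getElem? q
    rw [hs, Option.bind_some, hs']
    exact hty q
  · rw [h.width_eq]
    exact hmove (h.step q a) fun x hx => hsub x (List.mem_append_left _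
      (List.mem_flatMap.2 ⟨a, List.mem_finRange a, hx⟩))
  · rw [h.width_eq]
    obtain ⟨r, -, h1⟩ := (h.halt q).isTupleCode
      (fun x hx => hsub x (List.mem_append_right _ hx)) hp
    exact h1

end Tables

/-- The data that witness that a description presents a minimal transducer which is equivalent to
another one: a simulation, a list of words and a table of ranks. -/
abbrev Certificate (Γ : Type v) (m : ℕ) : Type v :=
  List (ℕ × CodeMove Γ) × List (List (Fin m)) × List (Γ × ℕ)

def Certifies [DecidableEq Γ] (c c' : Code Γ m) (x : Certificate Γ m) : Prop :=
  Simulates x.1 c c' ∧ IsReducedCode x.2.1 c' ∧ WellFormed x.2.2 c'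

variable [DecidableEq Γ] {A : Transducer (leafAlgebra rank) (Fin m)} {c c' : Code Γ m}

theorem Certifies.exists_minimal {x : Certificate Γ m} (h : Certifies c c' x)
    (hx : ∀ p ∈ x.2.2, rank p.1 = p.2) (hc : Presents c A) :
    ∃ M : Realizer A.transduction, Presents c' M.transducer ∧ AlgebraicallyMinimal M := by
  obtain ⟨h1, h2, h3⟩ := h
  obtain ⟨M, hM, hty⟩ := h3.exists_presents hx
  obtain ⟨e, he⟩ := hc.exists_presentsBy
  obtain ⟨e', he'⟩ := hM.exists_presentsBy
  obtain ⟨G, hG⟩ := he'.exists_isReduced hty h2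
  exact ⟨⟨M, (output_eq_of_codeOutput_eq he he' h1.codeOutput_eq).symm⟩, hM,
    hG.algebraicallyMinimal⟩

theorem Presents.exists_certifies (hc : Presents c A) :
    ∃ (c' : Code Γ m) (x : Certificate Γ m), Certifies c c' x ∧ ∀ p ∈ x.2.2, rank p.1 = p.2 := by
  obtain ⟨e, he⟩ := hc.exists_presentsBy
  have : Finite A.Q.carrier := Finite.of_equiv _ e.symm
  obtain ⟨M, G, hG, hM⟩ := exists_isReduced A.transduction
  have hMA : M.output = A.output := by
    unfold Transducer.output
    rw [hM]
  obtain ⟨f, hf⟩ := hG.exists_hom hMA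
  -- Every state of `M` is the target of some state of `A` under `f`, and a transformation has at
  -- most one target per state; so `M` has no more states than `A`.
  have : Finite M.Q.carrier := by
    have : ∀ r, ∃ q, ∃ d d', f.toFun ⟨q, d⟩ = some ⟨r, d'⟩ := fun r => by
      obtain ⟨w, d', hw⟩ := hG.reachable r
      obtain ⟨⟨q, d⟩, -, hq⟩ := Option.bind_eq_some_iff.1 ((hf w).symm.trans hw)
      exact ⟨q, d, d', hq⟩
    choose g hg using this
    refine Finite.of_injective g fun r r' hrr => ?_
    obtain ⟨d, d₁, h1⟩ := hg r
    obtain ⟨d', d₁', h2⟩ := hg r'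
    revert d' h2
    rw [← hrr]
    intro d' h2
    obtain ⟨y, hy⟩ := f.exists_eq_some h1 d'
    exact congrArg Sigma.fst (Option.some.inj (hy.symm.trans h2))
  obtain ⟨c', hc'⟩ := exists_presents M
  obtain ⟨e', he'⟩ := hc'.exists_presentsBy
  obtain ⟨L, hL⟩ := he.exists_simulates he' hM.symm f hf
  obtain ⟨W, hW⟩ := he'.exists_isReducedCode hG
  refine ⟨c', (L, W, _), ⟨hL, hW, he'.wellFormed hG.ty_ne_none⟩, fun p hp => ?_⟩
  obtain ⟨g, -, rfl⟩ := List.mem_map.1 hp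
  rfl

end STT

namespace STT

/-! ### Certificate checking is primitive recursive. -/

section Quantifiers

variable {α β : Type*} [Primcodable α] [Primcodable β]

theorem primrecPred_forall_mem {f : α → List β} {p : α → β → Prop} (hf : Primrec f)
    (hp : PrimrecPred fun y : α × β => p y.1 y.2) : PrimrecPred fun a => ∀ b ∈ f a, p a b :=
  PrimrecRel.comp (PrimrecRel.forall_mem_list (R := fun b a => p a b) (PrimrecRel.swap hp)) hf .id

theorem primrecPred_exists_mem {f : α → List β} {p : α → β → Prop} (hf : Primrec f)
    (hp : PrimrecPred fun y : α × β => p y.1 y.2) : PrimrecPred fun a => ∃ b ∈ f a, p a b :=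
  PrimrecRel.comp (PrimrecRel.exists_mem_list (R := fun b a => p a b) (PrimrecRel.swap hp)) hf .id

theorem primrecPred_forall_lt {f : α → ℕ} {p : α → ℕ → Prop} (hf : Primrec f)
    (hp : PrimrecPred fun y : α × ℕ => p y.1 y.2) : PrimrecPred fun a => ∀ n < f a, p a n :=
  (primrecPred_forall_mem (Primrec.list_range.comp hf) hp).of_eq fun a => by
    simp only [List.mem_range]

theorem primrecPred_forall_fin {m : ℕ} {p : α → Fin m → Prop}
    (hp : PrimrecPred fun y : α × Fin m => p y.1 y.2) : PrimrecPred fun a => ∀ i, p a i :=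
  (primrecPred_forall_mem (.const (List.finRange m)) hp).of_eq fun _ =>
    ⟨fun h i => h i (List.mem_finRange i), fun h i _ => h i⟩

theorem primrecPred_forall_some {f : α → Option β} {p : α → β → Prop} (hf : Primrec f)
    (hp : PrimrecPred fun y : α × β => p y.1 y.2) :
    PrimrecPred fun a => ∀ b, f a = some b → p a b :=
  (primrecPred_forall_mem (Primrec.optionToList.comp hf) hp).of_eq fun a => by
    simp only [Option.mem_toList]

theorem primrecPred_ne {f g : α → β} (hf : Primrec f) (hg : Primrec g) :
    PrimrecPred fun a => f a ≠ g a :=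
  (Primrec.eq.comp hf hg).not

end Quantifiers

section Codes

variable {Γ : Type v} [Primcodable Γ] {m : ℕ}

theorem primrec_holes : Primrec (holes : List (Option Γ) → ℕ) := by
  have h : Primrec fun l : List (Option Γ) =>
      l.foldr (fun o n => Option.casesOn o (n + 1) fun _ => n) 0 :=
    Primrec.list_foldr .id (.const 0) (Primrec.option_casesOn (Primrec.fst.comp .snd)
      (Primrec.succ.comp (Primrec.snd.comp .snd))
      ((Primrec.snd.comp (Primrec.snd.comp .fst)).to₂)).to₂
  refine h.of_eq fun l => ?_
  induction l with
  | nil => rfl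
  | cons o l ih =>
    rw [List.foldr_cons, ih]
    cases o <;> simp [holes]

/-- The recursion changes its second argument, so it is rewritten as a left fold whose state holds
the output so far and the unused part of the tuple. -/
theorem primrec_fill : Primrec₂ (fill : List (Option Γ) → TupleCode Γ → List (Option Γ)) := by
  have h : Primrec fun p : List (Option Γ) × TupleCode Γ =>
      (p.1.foldl (fun (s : List (Option Γ) × TupleCode Γ) o =>
        (Option.casesOn o (s.1 ++ s.2.head?.getD [], s.2.tail)
          fun g => (s.1 ++ [some g], s.2) : List (Option Γ) × TupleCode Γ)) ([], p.2)).1 := by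
    have step : Primrec₂ fun (_ : List (Option Γ) × TupleCode Γ)
        (sb : (List (Option Γ) × TupleCode Γ) × Option Γ) =>
        (Option.casesOn sb.2 (sb.1.1 ++ sb.1.2.head?.getD [], sb.1.2.tail)
          fun g => (sb.1.1 ++ [some g], sb.1.2) : List (Option Γ) × TupleCode Γ) := ?_
    · exact Primrec.fst.comp (Primrec.list_foldl .fst (Primrec.pair (.const []) .snd) step)
    have ho : Primrec fun q : (List (Option Γ) × TupleCode Γ) ×
        (List (Option Γ) × TupleCode Γ) × Option Γ => q.2.2 := Primrec.snd.comp .snd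
    refine Primrec.option_casesOn ho ?_ ?_
    · have hs := (Primrec.fst.comp .snd :
        Primrec fun q : (List (Option Γ) × TupleCode Γ) × (List (Option Γ) × TupleCode Γ) ×
          Option Γ => q.2.1)
      exact Primrec.pair (Primrec.list_append.comp (Primrec.fst.comp hs)
        (Primrec.option_getD.comp (Primrec.list_head?.comp (Primrec.snd.comp hs)) (.const [])))
        (Primrec.list_tail.comp (Primrec.snd.comp hs))
    · have hs := (Primrec.fst.comp (Primrec.snd.comp .fst) :
        Primrec fun q : ((List (Option Γ) × TupleCode Γ) × (List (Option Γ) × TupleCode Γ) ×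
          Option Γ) × Γ => q.1.2.1)
      exact (Primrec.pair (Primrec.list_append.comp (Primrec.fst.comp hs)
        (Primrec.list_cons.comp (Primrec.option_some.comp .snd) (.const [])))
        (Primrec.snd.comp hs)).to₂
  refine h.of_eq fun ⟨l, w⟩ => ?_
  have key : ∀ (l : List (Option Γ)) (x : List (Option Γ)) (w : TupleCode Γ),
      (l.foldl (fun (s : List (Option Γ) × TupleCode Γ) o =>
        (Option.casesOn o (s.1 ++ s.2.head?.getD [], s.2.tail)
          fun g => (s.1 ++ [some g], s.2) : List (Option Γ) × TupleCode Γ)) (x, w)).1 =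
      x ++ fill l w := by
    intro l
    induction l with
    | nil => intro x w; simp [fill]
    | cons o l ih =>
      intro x w
      cases o <;> simp [fill, ih, List.headD_eq_head?_getD]
  exact key l [] w

theorem primrec_compose : Primrec₂ (compose : TupleCode Γ → TupleCode Γ → TupleCode Γ) := by
  have h : Primrec fun p : TupleCode Γ × TupleCode Γ =>
      (p.1.foldl (fun (s : TupleCode Γ × TupleCode Γ) l =>
        ((s.1 ++ [fill l s.2], s.2.drop (holes l)) : TupleCode Γ × TupleCode Γ)) ([], p.2)).1 := by
    refine Primrec.fst.comp (Primrec.list_foldl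
      (h := fun _ sb => (sb.1.1 ++ [fill sb.2 sb.1.2], sb.1.2.drop (holes sb.2)))
      .fst (Primrec.pair (.const []) .snd) ?_)
    have hs := (Primrec.fst.comp .snd :
        Primrec fun q : (TupleCode Γ × TupleCode Γ) × (TupleCode Γ × TupleCode Γ) ×
          List (Option Γ) => q.2.1)
    have hl := (Primrec.snd.comp .snd :
        Primrec fun q : (TupleCode Γ × TupleCode Γ) × (TupleCode Γ × TupleCode Γ) ×
          List (Option Γ) => q.2.2)
    exact (Primrec.pair (Primrec.list_append.comp (Primrec.fst.comp hs)
      (Primrec.list_cons.comp (primrec_fill.comp hl (Primrec.snd.comp hs)) (.const [])))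
      (Primrec.list_drop.comp (primrec_holes.comp hl) (Primrec.snd.comp hs))).to₂
  refine h.of_eq fun ⟨x, w⟩ => ?_
  have key : ∀ (x y w : TupleCode Γ),
      (x.foldl (fun (s : TupleCode Γ × TupleCode Γ) l =>
        ((s.1 ++ [fill l s.2], s.2.drop (holes l)) : TupleCode Γ × TupleCode Γ)) (y, w)).1 =
      y ++ compose x w := by
    intro x
    induction x with
    | nil => intro y w; simp [compose]
    | cons l x ih => intro y w; simp [compose, ih]
  exact key x [] w

theorem primrec_after : Primrec₂ (after : TupleCode Γ → CodeMove Γ → CodeMove Γ) :=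
  Primrec.option_map .snd (Primrec.pair (Primrec.fst.comp .snd)
    (primrec_compose.comp (Primrec.fst.comp .fst) (Primrec.snd.comp .snd))).to₂

theorem primrec_andThen {α : Type*} [Primcodable α] {o : α → CodeMove Γ} {f : α → ℕ → CodeMove Γ}
    (ho : Primrec o) (hf : Primrec₂ f) : Primrec fun a => andThen (o a) (f a) :=
  Primrec.option_bind ho (primrec_after.comp (Primrec.snd.comp .snd)
    (hf.comp .fst (Primrec.fst.comp .snd))).to₂

variable {α : Type*} [Primcodable α]

theorem primrec_codeStep {c : α → Code Γ m} {a : α → Fin m} {k : α → ℕ} (hc : Primrec c)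
    (ha : Primrec a) (hk : Primrec k) : Primrec fun x => codeStep (c x) (a x) (k x) :=
  Primrec.option_bind (Primrec.list_getElem?.comp (Primrec.snd.comp hc) hk)
    (Primrec.fin_app.comp (Primrec.fst.comp (Primrec.snd.comp .snd)) (ha.comp .fst)).to₂

theorem primrec_codeHalt {c : α → Code Γ m} {k : α → ℕ} (hc : Primrec c) (hk : Primrec k) :
    Primrec fun x => codeHalt (c x) (k x) :=
  Primrec.option_bind (Primrec.list_getElem?.comp (Primrec.snd.comp hc) hk)
    (Primrec.option_map (Primrec.snd.comp (Primrec.snd.comp .snd))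
      (Primrec.pair (.const 0) .snd).to₂).to₂

theorem primrec_codeRun {c : α → Code Γ m} {o : α → CodeMove Γ} {w : α → List (Fin m)}
    (hc : Primrec c) (ho : Primrec o) (hw : Primrec w) :
    Primrec fun x => codeRun (c x) (o x) (w x) :=
  Primrec.list_foldl hw ho (primrec_andThen (Primrec.fst.comp .snd)
    (primrec_codeStep (hc.comp (Primrec.fst.comp .fst))
      (Primrec.snd.comp (Primrec.snd.comp .fst)) .snd).to₂).to₂

theorem primrec_arity : Primrec arity :=
  (Primrec.option_getD.comp .id (.const 1)).of_eq fun a => by cases a <;> rfl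

theorem primrec_width {c : α → Code Γ m} {k : α → ℕ} (hc : Primrec c) (hk : Primrec k) :
    Primrec fun x => width (c x) (k x) :=
  Primrec.option_getD.comp
    (Primrec.option_map (Primrec.list_getElem?.comp (Primrec.snd.comp hc) hk)
      (primrec_arity.comp (Primrec.fst.comp .snd)).to₂) (.const 0)

theorem primrec_replicate {β : Type*} [Primcodable β] (b : β) :
    Primrec fun n => List.replicate n b :=
  (Primrec.list_map Primrec.list_range (Primrec.const b).to₂).of_eq fun n => by
    simp [List.map_const']

theorem primrec_codeResidual {c : α → Code Γ m} {k : α → ℕ} {w : α → List (Fin m)}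
    (hc : Primrec c) (hk : Primrec k) (hw : Primrec w) :
    Primrec fun x => codeResidual (c x) (k x) (w x) :=
  primrec_andThen (primrec_codeRun hc (Primrec.option_some.comp
      (hk.pair ((primrec_replicate _).comp (primrec_width hc hk)))) hw)
    (primrec_codeHalt (hc.comp .fst) .snd).to₂

theorem primrec_rootAt {c : α → Code Γ m} {k i : α → ℕ} {w : α → List (Fin m)}
    (hc : Primrec c) (hk : Primrec k) (hi : Primrec i) (hw : Primrec w) :
    Primrec fun x => rootAt (c x) (k x) (i x) (w x) :=
  Primrec.option_bind (primrec_codeResidual hc hk hw)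
    (Primrec.option_bind (Primrec.list_getElem?.comp (Primrec.snd.comp .snd) (hi.comp .fst))
      (Primrec.list_head?.comp .snd).to₂).to₂

theorem primrecPred_related {L : α → List (ℕ × CodeMove Γ)} {o o' : α → CodeMove Γ}
    (hL : Primrec L) (ho : Primrec o) (ho' : Primrec o') :
    PrimrecPred fun x => Related (L x) (o x) (o' x) :=
  ((Primrec.eq.comp ho (.const none)).and (Primrec.eq.comp ho' (.const none))).or
    (primrecPred_exists_mem hL (PrimrecPred.and
      (Primrec.eq.comp (Primrec.option_map (ho.comp .fst) (Primrec.fst.comp .snd).to₂)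
        (Primrec.option_some.comp (Primrec.fst.comp .snd)))
      (Primrec.eq.comp (ho'.comp .fst) (Primrec.option_bind (ho.comp .fst)
        (primrec_after.comp (Primrec.snd.comp .snd)
          (Primrec.snd.comp (Primrec.snd.comp .fst))).to₂))))

theorem primrecPred_simulates {L : α → List (ℕ × CodeMove Γ)} {c c' : α → Code Γ m}
    (hL : Primrec L) (hc : Primrec c) (hc' : Primrec c') :
    PrimrecPred fun x => Simulates (L x) (c x) (c' x) := by
  refine (primrecPred_related hL (Primrec.fst.comp hc) (Primrec.fst.comp hc')).and
    (primrecPred_forall_mem hL (PrimrecPred.and (primrecPred_forall_fin ?_) ?_))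
  · exact (primrecPred_related (hL.comp (Primrec.fst.comp .fst))
      (primrec_codeStep (hc.comp (Primrec.fst.comp .fst)) .snd
        (Primrec.fst.comp (Primrec.snd.comp .fst)))
      (primrec_andThen (Primrec.snd.comp (Primrec.snd.comp .fst))
        (primrec_codeStep (hc'.comp (Primrec.fst.comp (Primrec.fst.comp .fst)))
          (Primrec.snd.comp .fst) .snd).to₂))
  · exact Primrec.eq.comp (primrec_codeHalt (hc.comp .fst) (Primrec.fst.comp .snd))
      (primrec_andThen (Primrec.snd.comp .snd)
        (primrec_codeHalt (hc'.comp (Primrec.fst.comp .fst)) .snd).to₂)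

theorem primrecPred_isReducedCode {W : α → List (List (Fin m))} {c : α → Code Γ m}
    (hW : Primrec W) (hc : Primrec c) : PrimrecPred fun x => IsReducedCode (W x) (c x) := by
  have hlen : Primrec fun x => (c x).2.length := Primrec.list_length.comp (Primrec.snd.comp hc)
  refine primrecPred_forall_lt hlen (PrimrecPred.and ?_ (PrimrecPred.and ?_
    (PrimrecPred.and ?_ ?_)))
  · exact primrecPred_exists_mem (hW.comp .fst) (Primrec.eq.comp
      (Primrec.option_map (primrec_codeRun (hc.comp (Primrec.fst.comp .fst))
        (Primrec.fst.comp (hc.comp (Primrec.fst.comp .fst))) .snd) (Primrec.fst.comp .snd).to₂)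
      (Primrec.option_some.comp (Primrec.snd.comp .fst)))
  · exact primrecPred_exists_mem (hW.comp .fst) (primrecPred_ne
      (primrec_codeResidual (hc.comp (Primrec.fst.comp .fst)) (Primrec.snd.comp .fst) .snd)
      (.const none))
  · have h1 : Primrec fun y : (((α × ℕ) × ℕ) × List (Fin m)) × List (Fin m) =>
        rootAt (c y.1.1.1.1) y.1.1.1.2 y.1.1.2 y.1.2 :=
      primrec_rootAt (hc.comp (Primrec.fst.comp (Primrec.fst.comp (Primrec.fst.comp .fst))))
        (Primrec.snd.comp (Primrec.fst.comp (Primrec.fst.comp .fst)))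
        (Primrec.snd.comp (Primrec.fst.comp .fst)) (Primrec.snd.comp .fst)
    have h2 : Primrec fun y : (((α × ℕ) × ℕ) × List (Fin m)) × List (Fin m) =>
        rootAt (c y.1.1.1.1) y.1.1.1.2 y.1.1.2 y.2 :=
      primrec_rootAt (hc.comp (Primrec.fst.comp (Primrec.fst.comp (Primrec.fst.comp .fst))))
        (Primrec.snd.comp (Primrec.fst.comp (Primrec.fst.comp .fst)))
        (Primrec.snd.comp (Primrec.fst.comp .fst)) .snd
    refine primrecPred_forall_lt (primrec_width (hc.comp .fst) .snd)
      (primrecPred_exists_mem (hW.comp (Primrec.fst.comp .fst))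
        (primrecPred_exists_mem (hW.comp (Primrec.fst.comp (Primrec.fst.comp .fst)))
          (PrimrecPred.and ?_ (PrimrecPred.and ?_ ?_))))
    · exact primrecPred_ne h1 (.const none)
    · exact primrecPred_ne h2 (.const none)
    · exact primrecPred_ne h1 h2
  · exact primrecPred_forall_lt (hlen.comp .fst) (PrimrecPred.or
      (Primrec.eq.comp (Primrec.snd.comp .fst) .snd)
      (primrecPred_exists_mem (hW.comp (Primrec.fst.comp .fst)) (primrecPred_ne
        (primrec_codeResidual (hc.comp (Primrec.fst.comp (Primrec.fst.comp .fst)))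
          (Primrec.snd.comp (Primrec.fst.comp .fst)) .snd)
        (primrec_codeResidual (hc.comp (Primrec.fst.comp (Primrec.fst.comp .fst)))
          (Primrec.snd.comp .fst) .snd))))

variable [DecidableEq Γ]

/-- The table stands in for `rank`, which is merely computable; with it the parser becomes primitive
recursive. -/
theorem primrec_height : Primrec₂ (height : List (Γ × ℕ) → List (Option Γ) → Option ℕ) := by
  have h : Primrec fun p : List (Γ × ℕ) × List (Option Γ) =>
      p.2.foldr (fun o s => (Option.casesOn o (s.map Nat.succ) fun g => s.bind fun h =>
        (p.1.lookup g).bind fun k => if k ≤ h then some (h - k + 1) else none : Option ℕ))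
        (some 0) := by
    have step : Primrec₂ fun (p : List (Γ × ℕ) × List (Option Γ)) (os : Option Γ × Option ℕ) =>
        (Option.casesOn os.1 (os.2.map Nat.succ) fun g => os.2.bind fun h =>
          (p.1.lookup g).bind fun k => if k ≤ h then some (h - k + 1) else none : Option ℕ) := ?_
    · exact Primrec.list_foldr .snd (.const (some 0)) step
    have ho : Primrec fun q : (List (Γ × ℕ) × List (Option Γ)) × Option Γ × Option ℕ => q.2.1 :=
      Primrec.fst.comp .snd
    refine Primrec.option_casesOn ho (Primrec.option_map
      (Primrec.snd.comp .snd) (Primrec.succ.comp .snd).to₂) ?_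
    refine (Primrec.option_bind (Primrec.snd.comp (Primrec.snd.comp .fst))
      (Primrec.option_bind (Primrec.listLookup.comp (Primrec.snd.comp .fst)
        (Primrec.fst.comp (Primrec.fst.comp (Primrec.fst.comp .fst))))
        (Primrec.ite (Primrec.nat_le.comp .snd (Primrec.snd.comp .fst))
          (Primrec.option_some.comp (Primrec.succ.comp
            (Primrec.nat_sub.comp (Primrec.snd.comp .fst) .snd))) (.const none)).to₂).to₂).to₂
  refine h.of_eq fun ⟨T, l⟩ => ?_
  dsimp only
  induction l with
  | nil => rfl
  | cons o l ih =>
    rw [List.foldr_cons, ih]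
    cases o <;> rfl

theorem primrecPred_isTupleCode {T : α → List (Γ × ℕ)} {a b : α → ℕ} {x : α → TupleCode Γ}
    (hT : Primrec T) (ha : Primrec a) (hb : Primrec b) (hx : Primrec x) :
    PrimrecPred fun y => IsTupleCode (T y) (a y) (b y) (x y) :=
  (Primrec.eq.comp (Primrec.list_length.comp hx) ha).and
    ((primrecPred_forall_mem hx (Primrec.eq.comp (primrec_height.comp (hT.comp .fst) .snd)
      (.const (some 1)))).and
      (Primrec.eq.comp (primrec_holes.comp (Primrec.list_flatten.comp hx)) hb))

theorem primrecPred_isMoveCode {T : α → List (Γ × ℕ)} {c : α → Code Γ m} {a : α → ℕ}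
    {o : α → CodeMove Γ} (hT : Primrec T) (hc : Primrec c) (ha : Primrec a) (ho : Primrec o) :
    PrimrecPred fun y => IsMoveCode (T y) (c y) (a y) (o y) :=
  primrecPred_forall_some ho (PrimrecPred.and
    (Primrec.nat_lt.comp (Primrec.fst.comp .snd)
      (Primrec.list_length.comp (Primrec.snd.comp (hc.comp .fst))))
    (primrecPred_isTupleCode (hT.comp .fst) (ha.comp .fst)
      (primrec_width (hc.comp .fst) (Primrec.fst.comp .snd)) (Primrec.snd.comp .snd)))

theorem primrecPred_wellFormed {T : α → List (Γ × ℕ)} {c : α → Code Γ m}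
    (hT : Primrec T) (hc : Primrec c) : PrimrecPred fun y => WellFormed (T y) (c y) := by
  refine (primrecPred_isMoveCode hT hc (.const 1) (Primrec.fst.comp hc)).and
    (primrecPred_forall_lt (Primrec.list_length.comp (Primrec.snd.comp hc))
      (PrimrecPred.and ?_ (PrimrecPred.and (primrecPred_forall_fin ?_)
        (primrecPred_forall_some ?_ ?_))))
  · exact primrecPred_ne (Primrec.option_bind
      (Primrec.list_getElem?.comp (Primrec.snd.comp (hc.comp .fst)) .snd)
      (Primrec.fst.comp .snd).to₂) (.const none)
  · exact (primrecPred_isMoveCode (hT.comp (Primrec.fst.comp .fst))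
      (hc.comp (Primrec.fst.comp .fst))
      (primrec_width (hc.comp (Primrec.fst.comp .fst)) (Primrec.snd.comp .fst))
      (primrec_codeStep (hc.comp (Primrec.fst.comp .fst)) .snd
        (Primrec.snd.comp .fst)))
  · exact primrec_codeHalt (hc.comp .fst) .snd
  · exact (primrecPred_isTupleCode (hT.comp (Primrec.fst.comp .fst))
      (primrec_width (hc.comp (Primrec.fst.comp .fst)) (Primrec.snd.comp .fst)) (.const 0)
      (Primrec.snd.comp .snd))

theorem primrecRel_certifies :
    PrimrecRel fun (c : Code Γ m) (y : Code Γ m × Certificate Γ m) => Certifies c y.1 y.2 :=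
  PrimrecPred.primrecRel ((primrecPred_simulates (Primrec.fst.comp (Primrec.snd.comp .snd)) .fst
    (Primrec.fst.comp .snd)).and
    ((primrecPred_isReducedCode (Primrec.fst.comp (Primrec.snd.comp (Primrec.snd.comp .snd)))
      (Primrec.fst.comp .snd)).and
      (primrecPred_wellFormed (Primrec.snd.comp (Primrec.snd.comp (Primrec.snd.comp .snd)))
        (Primrec.fst.comp .snd))))

end Codes

/-! ### The search for a certified description. -/

section Search

variable {Γ : Type v} [Primcodable Γ] {rank : Γ → ℕ}

/-- It is decidable whether a table of ranks is correct. -/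
theorem exists_computable_table (h : Computable rank) :
    ∃ t : List (Γ × ℕ) → Bool, Computable t ∧ ∀ T, t T = true ↔ ∀ p ∈ T, rank p.1 = p.2 := by
  -- The bounded quantifier is written as a recursion on the index, because `rank` is only
  -- computable and the primitive recursive quantifiers do not apply. An index past the end counts
  -- as correct.
  let t : List (Γ × ℕ) → ℕ → Bool := fun T n => Nat.rec (motive := fun _ => Bool) true
    (fun k b => b && ((T[k]?.map fun p => rank p.1 == p.2).getD true)) n
  have ht : ∀ T n, t T n = true ↔ ∀ k < n, ∀ p, T[k]? = some p → rank p.1 = p.2 := by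
    intro T n
    induction n with
    | zero => simp [t]
    | succ n ih =>
      have : t T (n + 1) = (t T n && ((T[n]?.map fun p => rank p.1 == p.2).getD true)) := rfl
      rw [this, Bool.and_eq_true, ih, Nat.forall_lt_succ_right]
      refine and_congr_right fun _ => ?_
      cases T[n]? <;> simp
  refine ⟨fun T => t T T.length, ?_, fun T => ?_⟩
  · have hget : Computable fun y : List (Γ × ℕ) × ℕ × Bool => y.1[y.2.1]? :=
      Computable.list_getElem?.comp .fst (Computable.fst.comp .snd)
    have heq : Computable₂ fun (_ : List (Γ × ℕ) × ℕ × Bool) (p : Γ × ℕ) => rank p.1 == p.2 :=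
      Primrec.beq.to_comp.comp (h.comp (Computable.fst.comp .snd)) (Computable.snd.comp .snd)
    have step : Computable₂ fun (T : List (Γ × ℕ)) (x : ℕ × Bool) =>
        x.2 && ((T[x.1]?.map fun p => rank p.1 == p.2).getD true) :=
      Primrec.and.to_comp.comp (Computable.snd.comp .snd)
        (Computable.option_getD (Computable.option_map hget heq) (.const true))
    exact Computable.nat_rec Computable.list_length (.const true) step
  · rw [ht]
    constructor
    · intro h p hp
      obtain ⟨k, hk, rfl⟩ := List.getElem_of_mem hp
      exact h k hk _ (List.getElem?_eq_getElem hk)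
    · intro h k _ p hp
      exact h p (List.mem_of_getElem? hp)

/-- A minimal transducer is found by a search for a certified description. -/
theorem exists_partrec_minimal (h : Computable rank) (m : ℕ) :
    ∃ f : Code Γ m →. Code Γ m, Partrec f ∧
      ∀ (A : Transducer (leafAlgebra rank) (Fin m)) (c : Code Γ m), Presents c A →
        ∃ c' ∈ f c, ∃ M : Realizer A.transduction,
          Presents c' M.transducer ∧ AlgebraicallyMinimal M := by
  classical
  obtain ⟨t, ht, htT⟩ := exists_computable_table h
  have hcert : Computable₂ fun (c : Code Γ m) (y : Code Γ m × Certificate Γ m) =>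
      decide (Certifies c y.1 y.2) := primrecRel_certifies.decide.to_comp
  -- The number `n` is read as a candidate description together with a certificate, and the
  -- candidate is returned if both checks succeed.
  let s : Code Γ m → ℕ → Option (Code Γ m) := fun c n =>
    (@Encodable.decode (Code Γ m × Certificate Γ m) Primcodable.toEncodable n).bind fun y =>
      bif decide (Certifies c y.1 y.2) && t y.2.2.2 then some y.1 else none
  have hs : Computable₂ s := by
    have hdec : Computable fun z : (Code Γ m × ℕ) × Code Γ m × Certificate Γ m =>
        decide (Certifies z.1.1 z.2.1 z.2.2) :=
      hcert.comp (Computable.fst.comp .fst) .snd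
    have htab : Computable fun z : (Code Γ m × ℕ) × Code Γ m × Certificate Γ m =>
        t z.2.2.2.2 :=
      ht.comp (Computable.snd.comp (Computable.snd.comp (Computable.snd.comp .snd)))
    have hand : Computable fun z : (Code Γ m × ℕ) × Code Γ m × Certificate Γ m =>
        decide (Certifies z.1.1 z.2.1 z.2.2) && t z.2.2.2.2 :=
      Primrec.and.to_comp.comp hdec htab
    have step : Computable₂ fun (x : Code Γ m × ℕ) (y : Code Γ m × Certificate Γ m) =>
        bif decide (Certifies x.1 y.1 y.2) && t y.2.2.2 then some y.1 else none :=
      Computable.cond hand (Computable.option_some.comp (Computable.fst.comp .snd)) (.const none)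
    have hdecode : Computable fun x : Code Γ m × ℕ =>
        @Encodable.decode (Code Γ m × Certificate Γ m) Primcodable.toEncodable x.2 :=
      Computable.decode.comp .snd
    exact Computable.option_bind hdecode step
  have hmem : ∀ c n c', c' ∈ s c n → ∃ x : Certificate Γ m, Certifies c c' x ∧
      ∀ p ∈ x.2.2, rank p.1 = p.2 := by
    intro c n c' hc'
    obtain ⟨y, -, hy⟩ := Option.bind_eq_some_iff.1 hc'
    cases hb : decide (Certifies c y.1 y.2) && t y.2.2.2 with
    | false =>
      rw [hb] at hy
      cases hy
    | true =>
      rw [hb] at hy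
      cases hy
      rw [Bool.and_eq_true, decide_eq_true_iff, htT] at hb
      exact ⟨y.2, hb⟩
  refine ⟨fun c => Nat.rfindOpt (s c), Partrec.rfindOpt hs, fun A c hc => ?_⟩
  have hdom : (Nat.rfindOpt (s c)).Dom := by
    -- Halting uses that `c` presents some transducer; the number of one certified pair is a
    -- successful search index.
    obtain ⟨c', x, hx, hT⟩ := hc.exists_certifies
    refine Nat.rfindOpt_dom.2 ⟨@Encodable.encode _ Primcodable.toEncodable (c', x), c', ?_⟩
    have : (decide (Certifies c c' x) && t x.2.2) = true := by
      rw [Bool.and_eq_true, decide_eq_true_iff, htT]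
      exact ⟨hx, hT⟩
    simp only [s, Encodable.encodek, Option.bind_some, this]
    rfl
  refine ⟨_, Part.get_mem hdom, ?_⟩
  obtain ⟨n, hn⟩ := Nat.rfindOpt_spec (Part.get_mem hdom)
  -- The answer may differ from the description used for halting; its own certificate shows that it
  -- is correct.
  obtain ⟨x, hx, hT⟩ := hmem c n _ hn
  exact hx.exists_minimal hT hc

end Search

end STT

theorem mainTheorem6 {Γ : Type v} (rank : Γ → ℕ) :
    -- every transduction realized by a downward transducer is realized by a minimal one
    (∀ (S : Type u)
      (φ : List S → Option ((STT.leafAlgebra rank).Dom (STT.leafAlgebra rank).halt)),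
      (∃ A : STT.Transducer (STT.leafAlgebra rank) S, A.transduction = φ) →
        ∃ M : STT.Realizer φ, STT.AlgebraicallyMinimal M) ∧
    -- a minimal one can be computed from any presentation of a finite transducer
    (∀ [Primcodable Γ], Computable rank → ∀ m : ℕ,
      ∃ f : STT.Code Γ m →. STT.Code Γ m, Partrec f ∧
        ∀ A : STT.Transducer (STT.leafAlgebra rank) (Fin m), Finite A.Q.carrier →
          (∃ c, STT.Presents c A) ∧
          ∀ c, STT.Presents c A → ∃ c' ∈ f c, ∃ M : STT.Realizer A.transduction,
            STT.Presents c' M.transducer ∧ STT.AlgebraicallyMinimal M) := by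
  refine ⟨fun S φ _ => ?_, fun h m => ?_⟩
  · obtain ⟨M, G, hG, hM⟩ := STT.exists_isReduced φ
    exact ⟨⟨M, hM⟩, hG.algebraicallyMinimal⟩
  · obtain ⟨f, hf, hA⟩ := STT.exists_partrec_minimal h m
    exact ⟨f, hf, fun A _ => ⟨STT.exists_presents A, hA A⟩⟩
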